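/- Let $d\in\mathbb N$, let $\mathscr D=C_c^\infty(\mathbb R^d;\mathbb C)$, let $\mathscr D'$ be the space of distributions on $\mathbb R^d$ (continuous complex-linear functionals on $\mathscr D$), and write $\langle f,T\rangle_2=T(\bar f)$ for $f\in\mathscr D$, $T\in\mathscr D'$. Let $\varpi\in L^\infty_{\mathrm{loc}}(\mathbb R^d)$ be real-valued with $\varpi\ge\mu$ almost everywhere for some $\mu>0$. Let $\mathcal F=\bigoplus_{n\ge0}L^2((\mathbb R^d)^n)_{\mathrm s}$ be the bosonic Fock space, with scalar product $\langle\cdot,\cdot\rangle_{\mathcal F}$ antilinear in the first argument, and let $\mathrm d\Gamma(\varpi)$ be the operator of multiplication by $\varpi(k_1)+\dots+\varpi(k_n)$ on the $n$-particle space, with its maximal domain in $\mathcal F$. Let $\mathcal F_{\mathrm{fin}}(\mathscr D)\subset\mathcal F$ be the linear span of the vectors $f_1\otimes_{\mathrm s}\cdots\otimes_{\mathrm s}f_n$ with $n\ge0$ and $f_1,\dots,f_n\in\mathscr D$, where $\otimes_{\mathrm s}$ denotes the orthogonal projection of the tensor product onto the symmetric functions. Let $g\in\mathscr D'$ be arbitrary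 (in the van Hove--Miyatake model with source $v$, $g=v/\varpi$). On $\mathcal F_{\mathrm{fin}}(\mathscr D)$ define the annihilation operator by linear extension of $$a(g)(f_1\otimes_{\mathrm s}\cdots\otimes_{\mathrm s}f_n)=\frac1{\sqrt n}\sum_{\ell=1}^n\overline{\langle f_\ell,g\rangle_2}\;f_1\otimes_{\mathrm s}\cdots\widehat{f_\ell}\cdots\otimes_{\mathrm s}f_n$$ ($a(g)=0$ on the vacuum sector $n=0$), and $e^{a(g)}=\sum_{k\ge0}a(g)^k/k!$, which is a finite sum on each vector. Let $\mathcal F_g$ be the Hilbert space completion of $\mathcal F_{\mathrm{fin}}(\mathscr D)$ with respect to $\langle\psi,\phi\rangle_g=\langle e^{a(g)}\psi,e^{a(g)}\phi\rangle_{\mathcal F}$, and let $\iota_g:\mathcal F_g\to\mathcal F$ be the bounded extension of $e^{a(g)}$. Let $\mathfrak q_g$ be the (symmetric, nonnegative, closable) form on $\mathcal F_g$ with domain $\mathcal F_{\mathrm{fin}}(\mathscr D)$ and $$\mathfrak q_g(\phi,\psi)=\langle e^{a(g)}\phi,\mathrm d\Gamma(\varpi)e^{a(g)}\psi\rangle_{\mathcal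 F},$$ let $\overline{\mathfrak q}_g$ be its closure, and let $H_g$ (the dressed van Hove--Miyatake Hamiltonian) be the operator associated with $\overline{\mathfrak q}_g$: $\psi\in\mathcal D(H_g)$ and $H_g\psi=\eta$ if and only if $\psi\in\mathcal D(\overline{\mathfrak q}_g)$ and $\overline{\mathfrak q}_g(\phi,\psi)=\langle\phi,\eta\rangle_g$ for all $\phi\in\mathcal D(\overline{\mathfrak q}_g)$. Then $\iota_g$ is unitary, i.e. $\iota_g^*\iota_g=1$ and $\iota_g\iota_g^*=1$; the operator $H_g$ is self-adjoint on $\mathcal F_g$; $\mathcal F_{\mathrm{fin}}(\mathscr D)$ is a core for $H_g$; and $$\iota_g\,H_g\,\iota_g^*=\mathrm d\Gamma(\varpi)$$ as an equality of unbounded operators on $\mathcal F$, including equality of domains. -/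

import Mathlib

open MeasureTheory Filter Topology
open scoped Distributions ContDiff ComplexConjugate InnerProductSpace ENNReal DirectSum

noncomputable section

namespace VanHove

/-- Momentum space `ℝ^d` with its Euclidean structure and Lebesgue measure. -/
abbrev Momentum (d : ℕ) : Type := EuclideanSpace ℝ (Fin d)

/-- The space `𝒟` of complex-valued compactly supported smooth functions on `ℝ^d`. -/
abbrev TestFn (d : ℕ) : Type := 𝓓((⊤ : TopologicalSpace.Opens (Momentum d)), ℂ)

/-- The space `𝒟'` of distributions on `ℝ^d`: continuous `ℂ`-linear functionals on `𝒟`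
with respect to its usual (LF) topology. -/
abbrev Distr (d : ℕ) : Type := TestFn d →L[ℂ] ℂ

/-- Complex conjugation of test functions. -/
def TestFn.conj {d : ℕ} (f : TestFn d) : TestFn d where
  toFun := fun x => (starRingEnd ℂ) (f x)
  contDiff' := Complex.conjCLE.contDiff.comp f.contDiff
  hasCompactSupport' := f.hasCompactSupport.comp_left (map_zero _)
  tsupport_subset' := fun _ _ => trivial

/-- The sesquilinear duality bracket `⟨f, T⟩₂ = T(f̄)` of `f ∈ 𝒟` and `T ∈ 𝒟'`. -/
def bracket {d : ℕ} (f : TestFn d) (T : Distr d) : ℂ := T f.conj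

/-- The functional `f ↦ conj ⟨f, g⟩₂` on `𝒟`, which is `ℂ`-linear. -/
def conjBracket {d : ℕ} (g : Distr d) : TestFn d →ₗ[ℂ] ℂ where
  toFun f := (starRingEnd ℂ) (bracket f g)
  map_add' f₁ f₂ := by
    have h : (f₁ + f₂).conj = f₁.conj + f₂.conj := by
      ext x; simp [TestFn.conj, ← TestFunction.toFun_eq_coe]
    simp [bracket, h]
  map_smul' c f := by
    have h : (c • f).conj = (starRingEnd ℂ c) • f.conj := by
      ext x; simp [TestFn.conj, ← TestFunction.toFun_eq_coe]
    simp [bracket, h]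

/-! ### Fock space -/

/-- Permuting the `n` momenta preserves Lebesgue measure on `(ℝ^d)^n`. -/
theorem measurePreserving_perm (d n : ℕ) (σ : Equiv.Perm (Fin n)) :
    MeasurePreserving (fun k : Fin n → Momentum d => k ∘ σ) := by
  have h := volume_preserving_arrowCongr' σ.symm (MeasurableEquiv.refl (Momentum d)) (.id volume)
  exact h

/-- The `n`-particle space `L²((ℝ^d)^n)_s` of permutation symmetric square-integrable
functions, as a subspace of `L²((ℝ^d)^n)`. -/
def symL2 (d n : ℕ) : Submodule ℂ (Lp ℂ 2 (volume : Measure (Fin n → Momentum d))) :=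
  ⨅ σ : Equiv.Perm (Fin n), LinearMap.eqLocus
    (Lp.compMeasurePreservingₗᵢ ℂ (fun k : Fin n → Momentum d => k ∘ σ)
      (measurePreserving_perm d n σ)).toLinearMap
    LinearMap.id

theorem mem_symL2 {d n : ℕ} {ψ : Lp ℂ 2 (volume : Measure (Fin n → Momentum d))} :
    ψ ∈ symL2 d n ↔ ∀ σ : Equiv.Perm (Fin n), ∀ᵐ k, ψ (k ∘ σ) = ψ k := by
  simp only [symL2, Submodule.mem_iInf, LinearMap.mem_eqLocus]
  refine forall_congr' fun σ => ?_
  have h := Lp.coeFn_compMeasurePreserving ψ (measurePreserving_perm d n σ)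
  constructor
  · intro e
    have e' : Lp.compMeasurePreserving _ (measurePreserving_perm d n σ) ψ = ψ := e
    rw [e'] at h
    exact h.symm
  · intro e
    change Lp.compMeasurePreserving _ (measurePreserving_perm d n σ) ψ = ψ
    exact Lp.ext (h.trans e)

instance (d n : ℕ) : CompleteSpace (symL2 d n) := by
  have h : IsClosed (symL2 d n : Set (Lp ℂ 2 (volume : Measure (Fin n → Momentum d)))) := by
    simp only [symL2, Submodule.coe_iInf]
    refine isClosed_iInter fun σ => ?_
    exact isClosed_eq (LinearIsometry.continuous _) continuous_id
  exact h.completeSpace_coe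

/-- The bosonic Fock space `ℱ = ⨁ₙ L²((ℝ^d)^n)_s` (Hilbert space direct sum over `n ∈ ℕ₀`). -/
abbrev Fock (d : ℕ) : Type := lp (fun n : ℕ => symL2 d n) 2

/-- The graph of `dΓ(ϖ)` for a multiplication operator `ϖ`: pairs `(ψ, φ)` of Fock vectors with
`φ⁽ⁿ⁾(k₁,…,kₙ) = (ϖ(k₁) + ⋯ + ϖ(kₙ)) ψ⁽ⁿ⁾(k₁,…,kₙ)` for every `n`. -/
def secondQuantGraph {d : ℕ} (ϖ : Momentum d → ℝ) : Submodule ℂ (Fock d × Fock d) where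
  carrier := {p | ∀ n : ℕ, ∀ᵐ k : Fin n → Momentum d,
    ((p.2 n : symL2 d n) : Lp ℂ 2 volume) k
      = ((∑ i, ϖ (k i) : ℝ) : ℂ) * ((p.1 n : symL2 d n) : Lp ℂ 2 volume) k}
  zero_mem' := fun n => by
    filter_upwards [Lp.coeFn_zero ℂ 2 (volume : Measure (Fin n → Momentum d))] with k hk
    change (0 : Lp ℂ 2 (volume : Measure (Fin n → Momentum d))) k
      = _ * (0 : Lp ℂ 2 (volume : Measure (Fin n → Momentum d))) k
    rw [hk]
    exact (mul_zero _).symm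
  add_mem' := fun {p q} hp hq n => by
    filter_upwards [hp n, hq n, Lp.coeFn_add (p.1 n : Lp ℂ 2 volume) (q.1 n : Lp ℂ 2 volume),
      Lp.coeFn_add (p.2 n : Lp ℂ 2 volume) (q.2 n : Lp ℂ 2 volume)] with k h1 h2 h3 h4
    simp only [Prod.fst_add, Prod.snd_add, lp.coeFn_add, Pi.add_apply, Submodule.coe_add] at *
    rw [h3, h4, h1, h2, mul_add]
  smul_mem' := fun c p hp n => by
    filter_upwards [hp n, Lp.coeFn_smul c (p.1 n : Lp ℂ 2 volume),
      Lp.coeFn_smul c (p.2 n : Lp ℂ 2 volume)] with k h1 h3 h4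
    simp only [Prod.smul_fst, Prod.smul_snd, lp.coeFn_smul, Pi.smul_apply, Submodule.coe_smul,
      smul_eq_mul] at *
    rw [h3, h4, h1]
    ring

theorem secondQuantGraph_single {d : ℕ} (ϖ : Momentum d → ℝ) (p : Fock d × Fock d)
    (hp : p ∈ secondQuantGraph ϖ) (h0 : p.1 = 0) : p.2 = 0 := by
  apply lp.ext
  funext n
  apply Subtype.ext
  apply Lp.ext
  filter_upwards [hp n, Lp.coeFn_zero ℂ 2 (volume : Measure (Fin n → Momentum d))] with k h1 h2
  have h3 : ((p.1 n : symL2 d n) : Lp ℂ 2 volume) k = 0 := by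
    rw [h0]; exact h2
  rw [h1, h3, mul_zero]
  exact h2.symm

/-- The second quantization `dΓ(ϖ)` of the operator of multiplication by `ϖ`, acting on its
maximal domain `{ψ ∈ ℱ : ∑ₙ ‖(ϖ(k₁) + ⋯ + ϖ(kₙ)) ψ⁽ⁿ⁾‖² < ∞}`. -/
def secondQuant {d : ℕ} (ϖ : Momentum d → ℝ) : Fock d →ₗ.[ℂ] Fock d :=
  (secondQuantGraph ϖ).toLinearPMap

theorem secondQuant_graph {d : ℕ} (ϖ : Momentum d → ℝ) :
    (secondQuant ϖ).graph = secondQuantGraph ϖ :=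
  Submodule.toLinearPMap_graph_eq _ (secondQuantGraph_single ϖ)

/-! ### The finite particle space over test functions -/

/-- The symmetrized tensor product `f₁ ⊗ₛ ⋯ ⊗ₛ fₙ`, i.e. the orthogonal projection of
`f₁ ⊗ ⋯ ⊗ fₙ` onto the symmetric functions, as a function on `(ℝ^d)^n`. -/
def symProd {d n : ℕ} (f : Fin n → TestFn d) : (Fin n → Momentum d) → ℂ :=
  fun k => (n.factorial : ℂ)⁻¹ * ∑ σ : Equiv.Perm (Fin n), ∏ i, f (σ i) (k i)

/-- The `n`-particle sector of `ℱ_fin(𝒟)`: the linear span of the products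
`f₁ ⊗ₛ ⋯ ⊗ₛ fₙ` with `f₁, …, fₙ ∈ 𝒟`. -/
def FinSector (d n : ℕ) : Submodule ℂ ((Fin n → Momentum d) → ℂ) :=
  Submodule.span ℂ (Set.range (symProd (d := d) (n := n)))

theorem symProd_mem {d n : ℕ} (f : Fin n → TestFn d) : symProd f ∈ FinSector d n :=
  Submodule.subset_span ⟨f, rfl⟩

/-- The element `f₁ ⊗ₛ ⋯ ⊗ₛ fₙ` of the `n`-particle sector. -/
def symTensor {d n : ℕ} (f : Fin n → TestFn d) : FinSector d n := ⟨symProd f, symProd_mem f⟩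

/-- The finite particle space `ℱ_fin(𝒟)`, as the algebraic direct sum of its sectors; it is
embedded into Fock space by `toFock` below. -/
def FinParticle (d : ℕ) : Type := ⨁ n : ℕ, FinSector d n

instance (d : ℕ) : AddCommGroup (FinParticle d) :=
  inferInstanceAs (AddCommGroup (⨁ n : ℕ, FinSector d n))

instance (d : ℕ) : Module ℂ (FinParticle d) :=
  inferInstanceAs (Module ℂ (⨁ n : ℕ, FinSector d n))

namespace FinParticle

/-- The `n`-particle component of a finite particle vector. -/
def component (d n : ℕ) : FinParticle d →ₗ[ℂ] FinSector d n :=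
  DirectSum.component ℂ ℕ (fun n => FinSector d n) n

/-- The inclusion of the `n`-particle sector. -/
def of (d n : ℕ) : FinSector d n →ₗ[ℂ] FinParticle d :=
  DirectSum.lof ℂ ℕ (fun n => FinSector d n) n

/-- The linear map on `ℱ_fin(𝒟)` with prescribed restrictions to the sectors. -/
def lift {d : ℕ} {M : Type*} [AddCommGroup M] [Module ℂ M]
    (F : (n : ℕ) → FinSector d n →ₗ[ℂ] M) : FinParticle d →ₗ[ℂ] M :=
  DirectSum.toModule ℂ ℕ M F

theorem lift_of {d : ℕ} {M : Type*} [AddCommGroup M] [Module ℂ M]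
    (F : (n : ℕ) → FinSector d n →ₗ[ℂ] M) (n : ℕ) (Ψ : FinSector d n) :
    lift F (of d n Ψ) = F n Ψ :=
  DirectSum.toModule_lof (M := fun n => FinSector d n) ℂ n Ψ

theorem component_of_self {d n : ℕ} (Ψ : FinSector d n) : component d n (of d n Ψ) = Ψ :=
  DirectSum.component.lof_self ℂ (M := fun n => FinSector d n) n Ψ

theorem component_of_ne {d m n : ℕ} (h : n ≠ m) (Ψ : FinSector d m) :
    component d n (of d m Ψ) = 0 :=
  DirectSum.of_eq_of_ne (β := fun n => FinSector d n) m n Ψ h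

theorem ext {d : ℕ} {ψ φ : FinParticle d} (h : ∀ n, component d n ψ = component d n φ) : ψ = φ :=
  DFinsupp.ext h

theorem induction {d : ℕ} {P : FinParticle d → Prop} (ψ : FinParticle d) (h0 : P 0)
    (hof : ∀ n Ψ, P (of d n Ψ)) (hadd : ∀ ψ φ, P ψ → P φ → P (ψ + φ)) : P ψ :=
  DirectSum.induction_on (β := fun n => FinSector d n) ψ h0 hof hadd

end FinParticle

theorem FinSector.induction {d n : ℕ} {P : ((Fin n → Momentum d) → ℂ) → Prop}
    (hprod : ∀ f : Fin n → TestFn d, P (symProd f)) (h0 : P 0)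
    (hadd : ∀ Ψ Φ, P Ψ → P Φ → P (Ψ + Φ)) (hsmul : ∀ (c : ℂ) Ψ, P Ψ → P (c • Ψ))
    (Ψ : FinSector d n) : P Ψ := by
  refine Submodule.span_induction (p := fun x _ => P x) ?_ h0 ?_ ?_ Ψ.2
  · rintro _ ⟨f, rfl⟩; exact hprod f
  · intro x y _ _ hx hy; exact hadd x y hx hy
  · intro c x _ hx; exact hsmul c x hx

theorem FinSector.continuous {d n : ℕ} (Ψ : FinSector d n) :
    Continuous (Ψ : (Fin n → Momentum d) → ℂ) := by
  refine FinSector.induction (P := fun Ψ => Continuous Ψ) ?_ continuous_const ?_ ?_ Ψ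
  · intro f
    unfold symProd
    refine continuous_const.mul (continuous_finsetSum _ fun σ _ => continuous_finsetProd _ fun i _ => ?_)
    exact (f (σ i)).continuous.comp (continuous_apply i)
  · intro _ _ h1 h2; exact h1.add h2
  · intro c _ h; exact h.const_smul c

theorem FinSector.exists_compact {d n : ℕ} (Ψ : FinSector d n) :
    ∃ K : Set (Momentum d), IsCompact K ∧
      ∀ k : Fin n → Momentum d, (Ψ : (Fin n → Momentum d) → ℂ) k ≠ 0 → ∀ i, k i ∈ K := by
  refine FinSector.induction (P := fun Ψ => ∃ K : Set (Momentum d), IsCompact K ∧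
      ∀ k : Fin n → Momentum d, Ψ k ≠ 0 → ∀ i, k i ∈ K) ?_ ⟨∅, isCompact_empty, ?_⟩ ?_ ?_ Ψ
  · intro f
    refine ⟨⋃ i, tsupport (f i), isCompact_iUnion fun i => (f i).hasCompactSupport, ?_⟩
    intro k hk i
    obtain ⟨σ, -, hσ⟩ := Finset.exists_ne_zero_of_sum_ne_zero (right_ne_zero_of_mul hk)
    have h := Finset.prod_ne_zero_iff.1 hσ i (Finset.mem_univ i)
    exact Set.mem_iUnion.2 ⟨σ i, subset_tsupport _ h⟩
  · intro k hk; exact absurd rfl hk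
  · rintro Ψ Φ ⟨K, hK, h1⟩ ⟨L, hL, h2⟩
    refine ⟨K ∪ L, hK.union hL, fun k hk i => ?_⟩
    by_cases h : Ψ k = 0
    · right
      refine h2 k (fun h' => hk ?_) i
      simp [h, h']
    · exact Or.inl (h1 k h i)
  · rintro c Ψ ⟨K, hK, h1⟩
    exact ⟨K, hK, fun k hk i => h1 k (fun h => hk (by simp [h])) i⟩

theorem FinSector.memLp {d n : ℕ} (Ψ : FinSector d n) :
    MemLp (Ψ : (Fin n → Momentum d) → ℂ) 2 volume := by
  obtain ⟨K, hK, h⟩ := FinSector.exists_compact Ψ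
  refine (FinSector.continuous Ψ).memLp_of_hasCompactSupport ?_
  refine HasCompactSupport.intro (isCompact_univ_pi fun _ : Fin n => hK) fun k hk => ?_
  by_contra h0
  exact hk fun i _ => h k h0 i

theorem FinSector.symmetric {d n : ℕ} (Ψ : FinSector d n) (σ : Equiv.Perm (Fin n))
    (k : Fin n → Momentum d) :
    (Ψ : (Fin n → Momentum d) → ℂ) (k ∘ σ) = (Ψ : (Fin n → Momentum d) → ℂ) k := by
  refine FinSector.induction (P := fun Ψ => Ψ (k ∘ σ) = Ψ k) ?_ rfl ?_ ?_ Ψ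
  · intro f
    unfold symProd
    congr 1
    refine Fintype.sum_equiv (Equiv.mulRight σ⁻¹) _ _ fun τ => ?_
    refine Fintype.prod_equiv σ _ _ fun i => ?_
    simp
  · intro _ _ h1 h2; simp [h1, h2]
  · intro c _ h; simp [h]

/-- The `n`-particle sector of `ℱ_fin(𝒟)` as a subspace of `L²((ℝ^d)^n)_s`. -/
def FinSector.toSymL2 (d n : ℕ) : FinSector d n →ₗ[ℂ] symL2 d n where
  toFun Ψ := ⟨(FinSector.memLp Ψ).toLp _, mem_symL2.2 fun σ => by
    have h := (FinSector.memLp Ψ).coeFn_toLp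
    filter_upwards [h, (measurePreserving_perm d n σ).quasiMeasurePreserving.ae h] with k h1 h2
    rw [h1, h2, FinSector.symmetric Ψ]⟩
  map_add' _ _ := rfl
  map_smul' _ _ := rfl

/-- The inclusion of `ℱ_fin(𝒟)` into Fock space. -/
def toFock (d : ℕ) : FinParticle d →ₗ[ℂ] Fock d :=
  FinParticle.lift fun n =>
    (lp.lsingle (𝕜 := ℂ) (E := fun n : ℕ => symL2 d n) 2 n) ∘ₗ FinSector.toSymL2 d n

theorem toFock_apply {d : ℕ} (ψ : FinParticle d) (n : ℕ) :
    (toFock d ψ) n = FinSector.toSymL2 d n (FinParticle.component d n ψ) := by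
  induction ψ using FinParticle.induction with
  | h0 => rw [map_zero, map_zero, map_zero]; rfl
  | hof m x =>
    have h : toFock d (FinParticle.of d m x) = lp.single 2 m (FinSector.toSymL2 d m x) :=
      FinParticle.lift_of _ m x
    rw [h]
    by_cases e : n = m
    · subst e; rw [lp.single_apply_self, FinParticle.component_of_self]
    · rw [lp.single_apply_ne _ _ _ e, FinParticle.component_of_ne e, map_zero]
  | hadd x y hx hy =>
    rw [map_add, map_add, map_add, ← hx, ← hy]; rfl

/-- The inclusion is injective, so `FinParticle d` is a subspace of Fock space. -/
theorem toFock_injective (d : ℕ) : Function.Injective (toFock d) := by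
  refine (injective_iff_map_eq_zero (toFock d)).2 fun ψ hψ => ?_
  refine FinParticle.ext fun n => Subtype.ext ?_
  set Ψ := FinParticle.component d n ψ with hΨ
  have h : FinSector.toSymL2 d n Ψ = 0 := by rw [hΨ, ← toFock_apply, hψ]; rfl
  have h1 : (FinSector.memLp Ψ).toLp _ = 0 := congrArg Subtype.val h
  have h2 := (FinSector.memLp Ψ).coeFn_toLp
  rw [h1] at h2
  have h3 := (Lp.coeFn_zero ℂ 2 (volume : Measure (Fin n → Momentum d))).symm.trans h2
  rw [map_zero]
  exact ((continuous_const.ae_eq_iff_eq _ (FinSector.continuous Ψ)).1 h3).symm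

/-! ### Annihilation operators and the dressing transformation -/

/-- Expansion of `f₁ ⊗ₛ ⋯ ⊗ₛ fₙ₊₁` along its first variable. -/
theorem symProd_cons {d n : ℕ} (f : Fin (n + 1) → TestFn d) (x : Momentum d)
    (k : Fin n → Momentum d) :
    symProd f (Fin.cons x k)
      = ((n : ℂ) + 1)⁻¹ * ∑ l, symProd (fun i => f (l.succAbove i)) k * f l x := by
  let e : Fin (n + 1) × Equiv.Perm (Fin n) → Equiv.Perm (Fin (n + 1)) := fun p =>
    ((finSuccEquiv' 0).trans (Equiv.optionCongr p.2)).trans (finSuccEquiv' p.1).symm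
  have e0 : ∀ p, e p 0 = p.1 := fun p => by simp [e]
  have e1 : ∀ p i, e p (Fin.succ i) = p.1.succAbove (p.2 i) := fun p i => by
    simp only [e, Equiv.trans_apply, finSuccEquiv'_zero, finSuccEquiv_succ]
    simp
  have hinj : Function.Injective e := by
    intro p q h
    have h0 : p.1 = q.1 := by rw [← e0 p, ← e0 q, h]
    refine Prod.ext h0 (Equiv.ext fun i => ?_)
    have h1 := e1 p i
    rw [h, e1 q i, h0] at h1
    exact (Fin.succAbove_right_injective h1).symm
  have hbij : Function.Bijective e := by
    refine (Fintype.bijective_iff_injective_and_card e).2 ⟨hinj, ?_⟩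
    simp [Fintype.card_perm, Nat.factorial_succ]
  unfold symProd
  rw [← hbij.sum_comp, Fintype.sum_prod_type, Nat.factorial_succ, Nat.cast_mul, mul_inv,
    mul_assoc, Finset.mul_sum, Nat.cast_succ]
  congr 1
  refine Finset.sum_congr rfl fun l _ => ?_
  rw [mul_assoc, Finset.sum_mul]
  congr 1
  refine Finset.sum_congr rfl fun σ _ => ?_
  rw [Fin.prod_univ_succ, mul_comm]
  simp [e0, e1]

theorem FinSector.section_smooth {d n : ℕ} (Ψ : FinSector d (n + 1)) (k : Fin n → Momentum d) :
    ContDiff ℝ ∞ (fun x => (Ψ : (Fin (n + 1) → Momentum d) → ℂ) (Fin.cons x k)) := by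
  refine FinSector.induction (P := fun Ψ => ContDiff ℝ ∞ fun x => Ψ (Fin.cons x k))
    ?_ contDiff_const ?_ ?_ Ψ
  · intro f
    simp only [symProd_cons]
    exact contDiff_const.mul (ContDiff.sum fun l _ => contDiff_const.mul (f l).contDiff)
  · intro _ _ h1 h2; exact h1.add h2
  · intro c _ h; exact contDiff_const.mul h

theorem FinSector.section_compact {d n : ℕ} (Ψ : FinSector d (n + 1)) (k : Fin n → Momentum d) :
    HasCompactSupport (fun x => (Ψ : (Fin (n + 1) → Momentum d) → ℂ) (Fin.cons x k)) := by
  obtain ⟨K, hK, h⟩ := FinSector.exists_compact Ψ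
  refine HasCompactSupport.intro hK fun x hx => ?_
  by_contra h0
  exact hx (h _ h0 0)

/-- The section `x ↦ Ψ(x, k₁, …, kₙ)` of a vector in the `(n+1)`-particle sector, which is a
test function. -/
def FinSector.sectionAt {d n : ℕ} (k : Fin n → Momentum d) : FinSector d (n + 1) →ₗ[ℂ] TestFn d where
  toFun Ψ :=
    { toFun := fun x => (Ψ : (Fin (n + 1) → Momentum d) → ℂ) (Fin.cons x k)
      contDiff' := FinSector.section_smooth Ψ k
      hasCompactSupport' := FinSector.section_compact Ψ k
      tsupport_subset' := fun _ _ => trivial }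
  map_add' _ _ := rfl
  map_smul' _ _ := rfl

theorem sectionAt_symTensor {d n : ℕ} (f : Fin (n + 1) → TestFn d) (k : Fin n → Momentum d) :
    FinSector.sectionAt k (symTensor f)
      = ((n : ℂ) + 1)⁻¹ • ∑ l, symProd (fun i => f (l.succAbove i)) k • f l := by
  ext x
  change symProd f (Fin.cons x k) = _
  rw [symProd_cons]
  simp

/-- The operator `a(g)` on the `(n+1)`-particle sector, pointwise:
`(a(g)Ψ)(k₁,…,kₙ) = √(n+1) conj ⟨Ψ(·, k₁, …, kₙ), g⟩₂`. -/
def annihilAux {d : ℕ} (g : Distr d) (n : ℕ) :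
    FinSector d (n + 1) →ₗ[ℂ] ((Fin n → Momentum d) → ℂ) where
  toFun Ψ := fun k => (√((n : ℝ) + 1) : ℂ) * conjBracket g (FinSector.sectionAt k Ψ)
  map_add' Ψ Φ := by funext k; simp [mul_add]
  map_smul' c Ψ := by funext k; simp; ring

/-- `a(g)(f₁ ⊗ₛ ⋯ ⊗ₛ fₙ₊₁)
  = (n+1)^{-1/2} ∑ₗ conj ⟨fₗ, g⟩₂ f₁ ⊗ₛ ⋯ f̂ₗ ⋯ ⊗ₛ fₙ₊₁` (the `l`-th factor omitted). -/
theorem annihilAux_symTensor {d n : ℕ} (g : Distr d) (f : Fin (n + 1) → TestFn d) :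
    annihilAux g n (symTensor f) = (√((n : ℝ) + 1) : ℂ)⁻¹ •
      ∑ l, (starRingEnd ℂ) (bracket (f l) g) • symProd (fun i => f (l.succAbove i)) := by
  funext k
  have h1 : ((√((n : ℝ) + 1) : ℝ) : ℂ) ≠ 0 := by
    exact_mod_cast (Real.sqrt_pos.2 (by positivity)).ne'
  have h2 : ((n : ℂ) + 1)⁻¹ = (√((n : ℝ) + 1) : ℂ)⁻¹ * (√((n : ℝ) + 1) : ℂ)⁻¹ := by
    rw [← mul_inv, ← Complex.ofReal_mul, Real.mul_self_sqrt (by positivity)]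
    push_cast; rfl
  change (√((n : ℝ) + 1) : ℂ) * conjBracket g (FinSector.sectionAt k (symTensor f)) = _
  rw [sectionAt_symTensor, map_smul, map_sum, smul_eq_mul, h2]
  simp only [map_smul, smul_eq_mul, Pi.smul_apply, Finset.sum_apply]
  rw [← mul_assoc, ← mul_assoc, mul_inv_cancel₀ h1, one_mul]
  congr 1
  exact Finset.sum_congr rfl fun l _ => mul_comm _ _

theorem annihilAux_mem {d : ℕ} (g : Distr d) (n : ℕ) (Ψ : FinSector d (n + 1)) :
    annihilAux g n Ψ ∈ FinSector d n := by
  have h : (⊤ : Submodule ℂ (FinSector d (n + 1))) ≤ (FinSector d n).comap (annihilAux g n) := by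
    have ht : Submodule.span ℂ (Set.range (symTensor (d := d) (n := n + 1))) = ⊤ := by
      have h1 : Set.range (symTensor (d := d) (n := n + 1))
          = Subtype.val ⁻¹' Set.range (symProd (d := d) (n := n + 1)) := by
        ext Ψ
        exact ⟨fun ⟨f, hf⟩ => ⟨f, congrArg Subtype.val hf⟩, fun ⟨f, hf⟩ => ⟨f, Subtype.ext hf⟩⟩
      rw [h1]
      exact Submodule.span_span_coe_preimage
    rw [← ht, Submodule.span_le]
    rintro _ ⟨f, rfl⟩
    change annihilAux g n (symTensor f) ∈ FinSector d n
    rw [annihilAux_symTensor]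
    exact Submodule.smul_mem _ _ (Submodule.sum_mem _ fun l _ =>
      Submodule.smul_mem _ _ (symProd_mem _))
  exact h (Submodule.mem_top (x := Ψ))

/-- The restriction of `a(g)` to the `n`-particle sector; it vanishes for `n = 0`. -/
def annihilSector {d : ℕ} (g : Distr d) : (n : ℕ) → FinSector d n →ₗ[ℂ] FinParticle d
  | 0 => 0
  | n + 1 => FinParticle.of d n ∘ₗ (annihilAux g n).codRestrict (FinSector d n) (annihilAux_mem g n)

/-- The annihilation operator `a(g)` on `ℱ_fin(𝒟)`. -/
def annihil {d : ℕ} (g : Distr d) : FinParticle d →ₗ[ℂ] FinParticle d :=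
  FinParticle.lift (annihilSector g)

theorem annihil_of_zero {d : ℕ} (g : Distr d) (Ψ : FinSector d 0) :
    annihil g (FinParticle.of d 0 Ψ) = 0 := by
  rw [annihil, FinParticle.lift_of]; rfl

theorem annihil_symTensor {d n : ℕ} (g : Distr d) (f : Fin (n + 1) → TestFn d) :
    annihil g (FinParticle.of d (n + 1) (symTensor f)) = (√((n : ℝ) + 1) : ℂ)⁻¹ •
      ∑ l, (starRingEnd ℂ) (bracket (f l) g) •
        FinParticle.of d n (symTensor fun i => f (l.succAbove i)) := by
  rw [annihil, FinParticle.lift_of]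
  have h : (annihilAux g n).codRestrict (FinSector d n) (annihilAux_mem g n) (symTensor f)
      = (√((n : ℝ) + 1) : ℂ)⁻¹ • ∑ l, (starRingEnd ℂ) (bracket (f l) g) •
        symTensor fun i => f (l.succAbove i) := by
    refine Subtype.ext ?_
    refine (annihilAux_symTensor g f).trans ?_
    simp [symTensor]
  change FinParticle.of d n (LinearMap.codRestrict _ _ _ _) = _
  rw [h, map_smul, map_sum]
  simp only [map_smul]

/-- `a(g)ᵏ` vanishes on the `n`-particle sector for `k > n`. -/
theorem annihil_pow_of {d : ℕ} (g : Distr d) {n k : ℕ} (h : n < k) (Ψ : FinSector d n) :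
    (annihil g ^ k) (FinParticle.of d n Ψ) = 0 := by
  induction n generalizing k with
  | zero =>
    obtain ⟨k, rfl⟩ := Nat.exists_eq_succ_of_ne_zero h.ne'
    rw [pow_succ, Module.End.mul_apply, annihil_of_zero, map_zero]
  | succ n ih =>
    obtain ⟨k, rfl⟩ := Nat.exists_eq_succ_of_ne_zero (Nat.ne_zero_of_lt h)
    rw [pow_succ, Module.End.mul_apply]
    have h1 : annihil g (FinParticle.of d (n + 1) Ψ)
        = FinParticle.of d n ((annihilAux g n).codRestrict _ (annihilAux_mem g n) Ψ) :=
      FinParticle.lift_of _ _ _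
    rw [h1]
    exact ih (by omega) _

/-- The exponential `e^{a(g)} = ∑ₖ a(g)ᵏ / k!` on `ℱ_fin(𝒟)`. On the `n`-particle sector the
series is truncated at `k = n`, since `a(g)ᵏ` vanishes there for `k > n`. -/
def expAnnihil {d : ℕ} (g : Distr d) : FinParticle d →ₗ[ℂ] FinParticle d :=
  FinParticle.lift fun n =>
    ∑ k ∈ Finset.range (n + 1), (k.factorial : ℂ)⁻¹ • (annihil g ^ k) ∘ₗ FinParticle.of d n

/-! ### Closable positive forms and their operators -/

/-- A symmetric, nonnegative sesquilinear form (antilinear in the first argument) on a complex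
vector space `X` that is mapped linearly into the Hilbert space `H`. -/
structure PosForm (X H : Type*) [AddCommGroup X] [Module ℂ X] [NormedAddCommGroup H]
    [InnerProductSpace ℂ H] where
  emb : X →ₗ[ℂ] H
  form : X →ₗ⋆[ℂ] X →ₗ[ℂ] ℂ
  symm : ∀ x y, (starRingEnd ℂ) (form x y) = form y x
  nonneg : ∀ x, 0 ≤ (form x x).re

namespace PosForm

variable {X H : Type*} [AddCommGroup X] [Module ℂ X] [NormedAddCommGroup H]
  [InnerProductSpace ℂ H]

/-- Form convergence: `ψₙ → x` in `H` and `q(ψₙ - ψₘ) → 0` as `n, m → ∞`. -/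
def FormTendsto (q : PosForm X H) (ψ : ℕ → X) (x : H) : Prop :=
  Tendsto (fun n => q.emb (ψ n)) atTop (𝓝 x) ∧
    Tendsto (fun p : ℕ × ℕ => q.form (ψ p.1 - ψ p.2) (ψ p.1 - ψ p.2)) atTop (𝓝 0)

/-- A form is closable if `q(ψₙ) → 0` whenever `ψₙ → 0` in `H` and `q(ψₙ - ψₘ) → 0`. -/
def IsClosable (q : PosForm X H) : Prop :=
  ∀ ψ : ℕ → X, q.FormTendsto ψ 0 → Tendsto (fun n => q.form (ψ n) (ψ n)) atTop (𝓝 0)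

/-- The form as a (possibly degenerate) inner product. -/
@[reducible]
def core (q : PosForm X H) : PreInnerProductSpace.Core ℂ X where
  inner x y := q.form x y
  conj_inner_symm x y := q.symm y x
  re_inner_nonneg := q.nonneg
  add_left x y z := by simp
  smul_left x y c := by simp

theorem form_self (q : PosForm X H) (x : X) : q.form x x = ((q.form x x).re : ℂ) :=
  (Complex.conj_eq_iff_re.1 (q.symm x x)).symm

theorem tendsto_form_self_iff (q : PosForm X H) {α : Type*} (l : Filter α) (u : α → X) :
    letI := q.core
    letI : SeminormedAddCommGroup X := InnerProductSpace.Core.toSeminormedAddCommGroup (𝕜 := ℂ)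
    Tendsto (fun a => q.form (u a) (u a)) l (𝓝 0) ↔ Tendsto (fun a => ‖u a‖) l (𝓝 0) := by
  let := q.core
  let : SeminormedAddCommGroup X := InnerProductSpace.Core.toSeminormedAddCommGroup (𝕜 := ℂ)
  have h : ∀ a, ‖u a‖ = √(q.form (u a) (u a)).re := fun a => rfl
  have h2 : ∀ a, q.form (u a) (u a) = ((‖u a‖ ^ 2 : ℝ) : ℂ) := fun a => by
    rw [h, Real.sq_sqrt (q.nonneg _), ← q.form_self]
  constructor
  · intro ht
    have := (Complex.continuous_re.tendsto _).comp ht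
    have := (Real.continuous_sqrt.tendsto _).comp this
    simpa [Function.comp_def, h] using this
  · intro ht
    have := (Complex.continuous_ofReal.tendsto _).comp (ht.pow 2)
    simpa [Function.comp_def, h2] using this

theorem cauchy_iff (q : PosForm X H) (ψ : ℕ → X) :
    letI := q.core
    letI : SeminormedAddCommGroup X := InnerProductSpace.Core.toSeminormedAddCommGroup (𝕜 := ℂ)
    Tendsto (fun p : ℕ × ℕ => q.form (ψ p.1 - ψ p.2) (ψ p.1 - ψ p.2)) atTop (𝓝 0) ↔
      CauchySeq ψ := by
  let := q.core
  let : SeminormedAddCommGroup X := InnerProductSpace.Core.toSeminormedAddCommGroup (𝕜 := ℂ)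
  rw [q.tendsto_form_self_iff atTop fun p : ℕ × ℕ => ψ p.1 - ψ p.2,
    cauchySeq_iff_tendsto_dist_atTop_0]
  simp only [dist_eq_norm]

theorem FormTendsto.add {q : PosForm X H} {ψ φ : ℕ → X} {x y : H} (h1 : q.FormTendsto ψ x)
    (h2 : q.FormTendsto φ y) : q.FormTendsto (fun n => ψ n + φ n) (x + y) := by
  let := q.core
  let : SeminormedAddCommGroup X := InnerProductSpace.Core.toSeminormedAddCommGroup (𝕜 := ℂ)
  refine ⟨by simpa using h1.1.add h2.1, ?_⟩
  have e1 := (q.tendsto_form_self_iff atTop fun p : ℕ × ℕ => ψ p.1 - ψ p.2).1 h1.2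
  have e2 := (q.tendsto_form_self_iff atTop fun p : ℕ × ℕ => φ p.1 - φ p.2).1 h2.2
  refine (q.tendsto_form_self_iff atTop _).2 ?_
  refine squeeze_zero (fun _ => norm_nonneg _) (fun p => ?_) (by simpa using e1.add e2)
  rw [add_sub_add_comm]
  exact norm_add_le _ _

theorem FormTendsto.smul {q : PosForm X H} {ψ : ℕ → X} {x : H} (c : ℂ)
    (h : q.FormTendsto ψ x) : q.FormTendsto (fun n => c • ψ n) (c • x) := by
  refine ⟨by simpa using h.1.const_smul c, ?_⟩
  simpa [← smul_sub] using (h.2.const_mul (starRingEnd ℂ c)).const_mul c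

theorem FormTendsto.const (q : PosForm X H) (ψ : X) : q.FormTendsto (fun _ => ψ) (q.emb ψ) :=
  ⟨tendsto_const_nhds, by simp⟩

theorem FormTendsto.exists_lim {q : PosForm X H} (hq : q.IsClosable) {φ φ' ψ ψ' : ℕ → X} {x y : H}
    (hφ : q.FormTendsto φ y) (hφ' : q.FormTendsto φ' y)
    (hψ : q.FormTendsto ψ x) (hψ' : q.FormTendsto ψ' x) :
    ∃ c, Tendsto (fun n => q.form (φ n) (ψ n)) atTop (𝓝 c) ∧
      Tendsto (fun n => q.form (φ' n) (ψ' n)) atTop (𝓝 c) := by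
  let := q.core
  let : SeminormedAddCommGroup X := InnerProductSpace.Core.toSeminormedAddCommGroup (𝕜 := ℂ)
  let : InnerProductSpace ℂ X := InnerProductSpace.ofCore q.core
  have key : ∀ (u v : ℕ → X) (z : H), q.FormTendsto u z → q.FormTendsto v z →
      ∃ a : UniformSpace.Completion X, Tendsto (fun n => (u n : UniformSpace.Completion X)) atTop (𝓝 a) ∧
        Tendsto (fun n => (v n : UniformSpace.Completion X)) atTop (𝓝 a) := by
    intro u v z hu hv
    have hc : CauchySeq (fun n => (u n : UniformSpace.Completion X)) :=
      ((q.cauchy_iff u).1 hu.2).map (UniformSpace.Completion.uniformContinuous_coe X)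
    obtain ⟨a, ha⟩ := cauchySeq_tendsto_of_complete hc
    refine ⟨a, ha, ?_⟩
    have hd : q.FormTendsto (fun n => v n - u n) 0 := by
      have := hv.add (hu.smul (-1))
      simpa [← sub_eq_add_neg] using this
    have h0 := (q.tendsto_form_self_iff atTop _).1 (hq _ hd)
    have h1 : Tendsto (fun n => ((v n - u n : X) : UniformSpace.Completion X)) atTop (𝓝 0) := by
      rw [tendsto_zero_iff_norm_tendsto_zero]
      simpa only [UniformSpace.Completion.norm_coe] using h0
    have h2 := h1.add ha
    simpa [UniformSpace.Completion.coe_sub] using h2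
  obtain ⟨a, ha, ha'⟩ := key φ φ' y hφ hφ'
  obtain ⟨b, hb, hb'⟩ := key ψ ψ' x hψ hψ'
  have e : ∀ u v : X, q.form u v
      = inner ℂ (u : UniformSpace.Completion X) (v : UniformSpace.Completion X) := fun u v =>
    (UniformSpace.Completion.inner_coe u v).symm
  refine ⟨inner ℂ a b, ?_, ?_⟩
  · simpa only [e] using ha.inner hb
  · simpa only [e] using ha'.inner hb'

/-- The domain of the closure of a form: all limits of form convergent sequences. -/
def closureDomain (q : PosForm X H) : Submodule ℂ H where
  carrier := {x | ∃ ψ : ℕ → X, q.FormTendsto ψ x}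
  zero_mem' := ⟨fun _ => 0, by simpa using FormTendsto.const q 0⟩
  add_mem' := fun ⟨_, h1⟩ ⟨_, h2⟩ => ⟨_, h1.add h2⟩
  smul_mem' := fun c _ ⟨_, h⟩ => ⟨_, h.smul c⟩

/-- The closure `q̄(y, x) = limₙ q(φₙ, ψₙ)` of a closable form, where `φₙ` and `ψₙ` form converge
to `y` and `x`; see `tendsto_closureForm` for the independence of the chosen sequences. -/
def closureForm (q : PosForm X H) (y x : q.closureDomain) : ℂ :=
  limUnder atTop fun n => q.form (y.2.choose n) (x.2.choose n)

theorem tendsto_closureForm {q : PosForm X H} (hq : q.IsClosable) {φ ψ : ℕ → X}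
    {y x : q.closureDomain} (hφ : q.FormTendsto φ y) (hψ : q.FormTendsto ψ x) :
    Tendsto (fun n => q.form (φ n) (ψ n)) atTop (𝓝 (q.closureForm y x)) := by
  obtain ⟨c, h1, h2⟩ := FormTendsto.exists_lim hq hφ y.2.choose_spec hψ x.2.choose_spec
  rw [closureForm, h2.limUnder_eq]
  exact h1

/-- The graph of the operator `A` of the closure of a closable form: `x ∈ D(A)` and `A x = z` iff
`x ∈ D(q̄)` and `q̄(y, x) = ⟨y, z⟩` for all `y ∈ D(q̄)`. -/
def operatorGraph (q : PosForm X H) (hq : q.IsClosable) : Submodule ℂ (H × H) where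
  carrier := {p | ∃ hx : p.1 ∈ q.closureDomain,
    ∀ y : q.closureDomain, q.closureForm y ⟨p.1, hx⟩ = inner ℂ (y : H) p.2}
  zero_mem' := by
    refine ⟨zero_mem _, fun y => ?_⟩
    obtain ⟨φ, hφ⟩ := y.2
    have h := tendsto_closureForm hq (x := 0) hφ (by simpa using FormTendsto.const q 0)
    simp only [map_zero] at h
    refine (tendsto_nhds_unique h tendsto_const_nhds).trans ?_
    simp
  add_mem' := by
    rintro ⟨x, z⟩ ⟨x', z'⟩ ⟨hx, h⟩ ⟨hx', h'⟩
    refine ⟨add_mem hx hx', fun y => ?_⟩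
    obtain ⟨φ, hφ⟩ := y.2
    obtain ⟨ψ, hψ⟩ := id hx
    obtain ⟨ψ', hψ'⟩ := id hx'
    have h1 := tendsto_closureForm hq (x := ⟨x, hx⟩) hφ hψ
    have h2 := tendsto_closureForm hq (x := ⟨x', hx'⟩) hφ hψ'
    have h3 := tendsto_closureForm hq (x := ⟨x + x', add_mem hx hx'⟩) hφ (hψ.add hψ')
    simp only [map_add] at h3
    rw [h] at h1
    rw [h'] at h2
    exact (tendsto_nhds_unique h3 (h1.add h2)).trans (inner_add_right _ _ _).symm
  smul_mem' := by
    rintro c ⟨x, z⟩ ⟨hx, h⟩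
    refine ⟨Submodule.smul_mem _ c hx, fun y => ?_⟩
    obtain ⟨φ, hφ⟩ := y.2
    obtain ⟨ψ, hψ⟩ := id hx
    have h1 := tendsto_closureForm hq (x := ⟨x, hx⟩) hφ hψ
    have h3 := tendsto_closureForm hq (x := ⟨c • x, Submodule.smul_mem _ c hx⟩) hφ (hψ.smul c)
    simp only [map_smul, smul_eq_mul] at h3
    rw [h] at h1
    exact (tendsto_nhds_unique h3 (h1.const_mul c)).trans (inner_smul_right _ _ _).symm

/-- The operator associated with the closure of a (densely defined) closable form. -/
def operator (q : PosForm X H) (hq : q.IsClosable) : H →ₗ.[ℂ] H :=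
  (q.operatorGraph hq).toLinearPMap

theorem emb_mem_closureDomain (q : PosForm X H) (ψ : X) : q.emb ψ ∈ q.closureDomain :=
  ⟨_, FormTendsto.const q ψ⟩

theorem operator_graph (q : PosForm X H) (hq : q.IsClosable) (hd : DenseRange q.emb) :
    (q.operator hq).graph = q.operatorGraph hq := by
  refine Submodule.toLinearPMap_graph_eq _ ?_
  rintro ⟨x, z⟩ ⟨hx, h⟩ h0
  obtain rfl : x = 0 := h0
  refine hd.eq_zero_of_inner_right (𝕜 := ℂ) ?_
  intro ψ
  have h1 := tendsto_closureForm hq (x := ⟨0, hx⟩) (y := ⟨_, q.emb_mem_closureDomain ψ⟩)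
    (FormTendsto.const q ψ) (by simpa using FormTendsto.const q 0)
  rw [h] at h1
  simp only [map_zero] at h1
  exact tendsto_nhds_unique h1 tendsto_const_nhds

/-- A form `⟨Tφ, Bψ⟩` is closable if `‖Tψ‖` is the norm of `ψ` in `H`. -/
theorem isClosable_of_eq_inner (q : PosForm X H) {F : Type*} [NormedAddCommGroup F]
    [InnerProductSpace ℂ F] (T B : X → F) (hT : ∀ ψ, ‖T ψ‖ = ‖q.emb ψ‖)
    (hB : ∀ φ ψ, q.form φ ψ = inner ℂ (T φ) (B ψ)) : q.IsClosable := by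
  intro ψ hψ
  let := q.core
  let : SeminormedAddCommGroup X := InnerProductSpace.Core.toSeminormedAddCommGroup (𝕜 := ℂ)
  let : InnerProductSpace ℂ X := InnerProductSpace.ofCore q.core
  refine (q.tendsto_form_self_iff atTop _).2 ?_
  have hc : CauchySeq (fun n => (ψ n : UniformSpace.Completion X)) :=
    ((q.cauchy_iff ψ).1 hψ.2).map (UniformSpace.Completion.uniformContinuous_coe X)
  obtain ⟨a, ha⟩ := cauchySeq_tendsto_of_complete hc
  have hT0 : Tendsto (fun n => T (ψ n)) atTop (𝓝 0) := by
    rw [tendsto_zero_iff_norm_tendsto_zero]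
    simpa [hT] using hψ.1.norm
  have h0 : a = 0 := by
    refine (UniformSpace.Completion.denseRange_coe (α := X)).eq_zero_of_inner_left (𝕜 := ℂ) ?_
    intro φ
    have h1 : Tendsto (fun n => q.form (ψ n) φ) atTop (𝓝 (inner ℂ a (φ : UniformSpace.Completion X))) := by
      have := Filter.Tendsto.inner (𝕜 := ℂ) ha
        (tendsto_const_nhds (x := (φ : UniformSpace.Completion X)))
      exact this.congr fun n => UniformSpace.Completion.inner_coe _ _
    have h2 : Tendsto (fun n => q.form (ψ n) φ) atTop (𝓝 0) := by
      simp only [hB]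
      simpa using Filter.Tendsto.inner (𝕜 := ℂ) hT0 (tendsto_const_nhds (x := B φ))
    exact tendsto_nhds_unique h1 h2
  rw [h0] at ha
  have h1 := (continuous_norm.tendsto (0 : UniformSpace.Completion X)).comp ha
  rw [norm_zero] at h1
  exact h1.congr fun n => UniformSpace.Completion.norm_coe (ψ n)

end PosForm

/-! ### The dressed Hilbert space and the dressed Hamiltonian -/

/-- A boson dispersion relation: `ϖ ∈ L^∞_loc(ℝ^d)` with `ϖ ≥ μ` almost everywhere for some
mass `μ > 0`. -/
structure Dispersion (d : ℕ) where
  toFun : Momentum d → ℝ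
  locallyBounded : ∀ K : Set (Momentum d), IsCompact K → MemLp toFun ∞ (volume.restrict K)
  exists_mass : ∃ μ : ℝ, 0 < μ ∧ ∀ᵐ k, μ ≤ toFun k

instance (d : ℕ) : CoeFun (Dispersion d) fun _ => Momentum d → ℝ := ⟨Dispersion.toFun⟩

/-- The vector space `ℱ_fin(𝒟)`, to be equipped with `⟨·,·⟩_g`. -/
def PreDressed {d : ℕ} (_g : Distr d) : Type := FinParticle d

instance {d : ℕ} (g : Distr d) : AddCommGroup (PreDressed g) :=
  inferInstanceAs (AddCommGroup (FinParticle d))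

instance {d : ℕ} (g : Distr d) : Module ℂ (PreDressed g) :=
  inferInstanceAs (Module ℂ (FinParticle d))

/-- The dressing transformation `e^{a(g)}` as a map from `ℱ_fin(𝒟)` to Fock space. -/
def dressing {d : ℕ} (g : Distr d) : PreDressed g →ₗ[ℂ] Fock d := toFock d ∘ₗ expAnnihil g

instance {d : ℕ} (g : Distr d) : SeminormedAddCommGroup (PreDressed g) :=
  SeminormedAddCommGroup.induced (PreDressed g) (Fock d) (dressing g)

/-- The dressed scalar product `⟨ψ, φ⟩_g = ⟨e^{a(g)}ψ, e^{a(g)}φ⟩_ℱ` on `ℱ_fin(𝒟)`. -/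
instance {d : ℕ} (g : Distr d) : InnerProductSpace ℂ (PreDressed g) :=
  { NormedSpace.induced ℂ (PreDressed g) (Fock d) (dressing g) with
    inner := fun ψ φ => inner ℂ (dressing g ψ) (dressing g φ)
    norm_sq_eq_re_inner := fun ψ => norm_sq_eq_re_inner (𝕜 := ℂ) (dressing g ψ)
    conj_inner_symm := fun ψ φ => inner_conj_symm _ _
    add_left := fun ψ φ χ => by rw [map_add, inner_add_left]
    smul_left := fun ψ φ c => by rw [map_smul, inner_smul_left] }

/-- The dressed Hilbert space `ℱ_g`: the completion of `(ℱ_fin(𝒟), ⟨·,·⟩_g)`. Since `e^{a(g)}` is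
injective (it is unipotent with respect to the particle number), `⟨·,·⟩_g` is definite; the
completion used here is the Hausdorff one and does not need this fact. -/
abbrev DressedSpace {d : ℕ} (g : Distr d) : Type := UniformSpace.Completion (PreDressed g)

/-- The dense inclusion of `ℱ_fin(𝒟)` into `ℱ_g`. -/
def toDressed {d : ℕ} (g : Distr d) : FinParticle d →ₗ[ℂ] DressedSpace g :=
  (UniformSpace.Completion.toComplL (𝕜 := ℂ) (E := PreDressed g)).toLinearMap

theorem norm_toDressed {d : ℕ} (g : Distr d) (ψ : FinParticle d) :
    ‖toDressed g ψ‖ = ‖toFock d (expAnnihil g ψ)‖ :=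
  UniformSpace.Completion.norm_coe (E := PreDressed g) ψ

theorem inner_toDressed {d : ℕ} (g : Distr d) (ψ φ : FinParticle d) :
    inner ℂ (toDressed g ψ) (toDressed g φ)
      = inner ℂ (toFock d (expAnnihil g ψ)) (toFock d (expAnnihil g φ)) :=
  UniformSpace.Completion.inner_coe (E := PreDressed g) ψ φ

theorem denseRange_toDressed {d : ℕ} (g : Distr d) : DenseRange (toDressed g) :=
  UniformSpace.Completion.denseRange_coe (α := PreDressed g)

/-- The embedding `ι_g : ℱ_g → ℱ`, the bounded extension of `e^{a(g)}`. -/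
def iota {d : ℕ} (g : Distr d) : DressedSpace g →L[ℂ] Fock d :=
  ContinuousLinearMap.extend
    ({ toLinearMap := dressing g, norm_map' := fun _ => rfl } :
      PreDressed g →ₗᵢ[ℂ] Fock d).toContinuousLinearMap
    (UniformSpace.Completion.toComplL (𝕜 := ℂ) (E := PreDressed g))

theorem iota_toDressed {d : ℕ} (g : Distr d) (ψ : FinParticle d) :
    iota g (toDressed g ψ) = toFock d (expAnnihil g ψ) :=
  ContinuousLinearMap.extend_eq (E := PreDressed g) (Eₗ := DressedSpace g)
    (e := UniformSpace.Completion.toComplL (𝕜 := ℂ) (E := PreDressed g)) _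
    (denseRange_toDressed g) (UniformSpace.Completion.isUniformInducing_coe (PreDressed g)) ψ

/-- Multiplication of a vector in a sector by `ϖ(k₁) + ⋯ + ϖ(kₙ)` is square-integrable. -/
theorem memLp_dispersion_mul {d n : ℕ} (ϖ : Dispersion d) (Ψ : FinSector d n) :
    MemLp (fun k => ((∑ i, ϖ (k i) : ℝ) : ℂ) * (Ψ : (Fin n → Momentum d) → ℂ) k) 2 volume := by
  obtain ⟨K, hK, hΨ⟩ := FinSector.exists_compact Ψ
  have hlb := ϖ.locallyBounded
  have hmeas : AEStronglyMeasurable ϖ.toFun volume := by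
    have h1 : (⋃ m, Metric.closedBall (0 : Momentum d) (m : ℕ)) = Set.univ :=
      Metric.iUnion_closedBall_nat 0
    rw [← Measure.restrict_univ (μ := volume), ← h1]
    exact AEStronglyMeasurable.iUnion fun m =>
      (hlb _ (isCompact_closedBall _ _)).aestronglyMeasurable
  obtain ⟨C, hC⟩ : ∃ C : ℝ, ∀ᵐ x : Momentum d, x ∈ K → ‖ϖ x‖ ≤ C := by
    refine ⟨_, (ae_restrict_iff' hK.measurableSet).1
      (MeasureTheory.ae_le_lpNorm_exponent_top (hlb K hK))⟩
  have hev : ∀ i : Fin n, Measure.QuasiMeasurePreserving (fun k : Fin n → Momentum d => k i) :=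
    fun i => Measure.quasiMeasurePreserving_eval _ i
  have hm : AEStronglyMeasurable
      (fun k : Fin n → Momentum d => ((∑ i, ϖ (k i) : ℝ) : ℂ)) volume := by
    refine Complex.continuous_ofReal.comp_aestronglyMeasurable ?_
    exact Finset.aestronglyMeasurable_fun_sum _ fun i _ => hmeas.comp_quasiMeasurePreserving (hev i)
  refine MemLp.of_le_mul (c := n * C) (FinSector.memLp Ψ)
    (hm.mul (FinSector.memLp Ψ).aestronglyMeasurable) ?_
  filter_upwards [ae_all_iff.2 fun i => (hev i).ae hC] with k hk
  by_cases h0 : (Ψ : (Fin n → Momentum d) → ℂ) k = 0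
  · simp [h0]
  · rw [norm_mul]
    refine mul_le_mul_of_nonneg_right ?_ (norm_nonneg _)
    rw [Complex.norm_real]
    refine (norm_sum_le _ _).trans ?_
    refine (Finset.sum_le_sum fun i _ => hk i (hΨ k h0 i)).trans ?_
    simp

/-- `ℱ_fin(𝒟)` is contained in the domain of `dΓ(ϖ)`. -/
theorem toFock_mem_domain {d : ℕ} (ϖ : Dispersion d) (ψ : FinParticle d) :
    toFock d ψ ∈ (secondQuant ϖ).domain := by
  induction ψ using FinParticle.induction with
  | h0 => rw [map_zero]; exact zero_mem _
  | hadd x y hx hy => rw [map_add]; exact add_mem hx hy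
  | hof n Ψ =>
    let Φ : symL2 d n := ⟨(memLp_dispersion_mul ϖ Ψ).toLp _, mem_symL2.2 fun σ => by
      have h := (memLp_dispersion_mul ϖ Ψ).coeFn_toLp
      filter_upwards [h, (measurePreserving_perm d n σ).quasiMeasurePreserving.ae h] with k h1 h2
      rw [h1, h2, FinSector.symmetric Ψ]
      congr 2
      exact Equiv.sum_comp σ fun i => ϖ (k i)⟩
    have h : (toFock d (FinParticle.of d n Ψ), (lp.single 2 n Φ : Fock d))
        ∈ secondQuantGraph ϖ := by
      intro m
      by_cases e : m = n
      · subst e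
        have h1 : (toFock d (FinParticle.of d m Ψ)) m = FinSector.toSymL2 d m Ψ := by
          rw [toFock_apply, FinParticle.component_of_self]
        simp only [h1, lp.single_apply_self]
        filter_upwards [(memLp_dispersion_mul ϖ Ψ).coeFn_toLp,
          (FinSector.memLp Ψ).coeFn_toLp] with k h2 h3
        exact h2.trans (congrArg _ h3.symm)
      · have h1 : (toFock d (FinParticle.of d n Ψ)) m = 0 := by
          rw [toFock_apply, FinParticle.component_of_ne e, map_zero]
        simp only [h1, lp.single_apply_ne _ _ _ e]
        filter_upwards [Lp.coeFn_zero ℂ 2 (volume : Measure (Fin m → Momentum d))] with k hk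
        change (0 : Lp ℂ 2 (volume : Measure (Fin m → Momentum d))) k
          = _ * (0 : Lp ℂ 2 (volume : Measure (Fin m → Momentum d))) k
        rw [hk]
        exact (mul_zero _).symm
    rw [← secondQuant_graph] at h
    exact LinearPMap.mem_domain_of_mem_graph h

/-- The restriction of `dΓ(ϖ)` to `ℱ_fin(𝒟)`. -/
def secondQuantFin {d : ℕ} (ϖ : Dispersion d) : FinParticle d →ₗ[ℂ] Fock d :=
  (secondQuant ϖ).toFun ∘ₗ (toFock d).codRestrict (secondQuant ϖ).domain (toFock_mem_domain ϖ)

theorem secondQuantFin_graph {d : ℕ} (ϖ : Dispersion d) (ψ : FinParticle d) :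
    (toFock d ψ, secondQuantFin ϖ ψ) ∈ secondQuantGraph ϖ := by
  rw [← secondQuant_graph]
  exact (secondQuant ϖ).mem_graph ⟨toFock d ψ, toFock_mem_domain ϖ ψ⟩

theorem inner_secondQuantGraph {d : ℕ} (ϖ : Momentum d → ℝ) {p p' : Fock d × Fock d}
    (hp : p ∈ secondQuantGraph ϖ) (hp' : p' ∈ secondQuantGraph ϖ) :
    inner ℂ p.1 p'.2 = inner ℂ p.2 p'.1 := by
  change ∑' n, inner ℂ (p.1 n) (p'.2 n) = ∑' n, inner ℂ (p.2 n) (p'.1 n)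
  refine tsum_congr fun n => ?_
  rw [Submodule.coe_inner, Submodule.coe_inner, L2.inner_def, L2.inner_def]
  refine integral_congr_ae ?_
  filter_upwards [hp n, hp' n] with k h1 h2
  rw [h1, h2]
  simp only [RCLike.inner_apply, map_mul, Complex.conj_ofReal]
  ring

theorem re_inner_secondQuantGraph {d : ℕ} (ϖ : Dispersion d) {p : Fock d × Fock d}
    (hp : p ∈ secondQuantGraph ϖ) : 0 ≤ (inner ℂ p.1 p.2).re := by
  have hs := Complex.hasSum_re (lp.hasSum_inner (𝕜 := ℂ) p.1 p.2)
  refine hs.nonneg fun n => ?_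
  obtain ⟨μ, hμ, hb⟩ := ϖ.exists_mass
  have hev : ∀ i : Fin n, Measure.QuasiMeasurePreserving (fun k : Fin n → Momentum d => k i) :=
    fun i => Measure.quasiMeasurePreserving_eval _ i
  have e : inner ℂ (p.1 n) (p.2 n) = ((∫ k : Fin n → Momentum d,
      (∑ i, ϖ (k i)) * ‖((p.1 n : symL2 d n) : Lp ℂ 2 volume) k‖ ^ 2 : ℝ) : ℂ) := by
    rw [Submodule.coe_inner, L2.inner_def, ← integral_complex_ofReal]
    refine integral_congr_ae ?_
    filter_upwards [hp n] with k h1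
    rw [h1, RCLike.inner_apply, mul_assoc, Complex.mul_conj, Complex.normSq_eq_norm_sq]
    push_cast; rfl
  rw [e, Complex.ofReal_re]
  refine integral_nonneg_of_ae ?_
  filter_upwards [ae_all_iff.2 fun i => (hev i).ae hb] with k hk
  exact mul_nonneg (Finset.sum_nonneg fun i _ => hμ.le.trans (hk i)) (by positivity)

theorem secondQuantFin_symm {d : ℕ} (ϖ : Dispersion d) (φ ψ : FinParticle d) :
    inner ℂ (toFock d φ) (secondQuantFin ϖ ψ) = inner ℂ (secondQuantFin ϖ φ) (toFock d ψ) :=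
  inner_secondQuantGraph ϖ (p := (toFock d φ, secondQuantFin ϖ φ))
    (p' := (toFock d ψ, secondQuantFin ϖ ψ)) (secondQuantFin_graph ϖ φ) (secondQuantFin_graph ϖ ψ)

theorem secondQuantFin_nonneg {d : ℕ} (ϖ : Dispersion d) (ψ : FinParticle d) :
    0 ≤ (inner ℂ (toFock d ψ) (secondQuantFin ϖ ψ)).re :=
  re_inner_secondQuantGraph ϖ (p := (toFock d ψ, secondQuantFin ϖ ψ)) (secondQuantFin_graph ϖ ψ)

/-- The quadratic form `𝔮_g(φ, ψ) = ⟨e^{a(g)}φ, dΓ(ϖ) e^{a(g)}ψ⟩_ℱ` on `ℱ_fin(𝒟) ⊆ ℱ_g`. -/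
def dressedForm {d : ℕ} (ϖ : Dispersion d) (g : Distr d) :
    PosForm (FinParticle d) (DressedSpace g) where
  emb := toDressed g
  form := LinearMap.mk₂'ₛₗ (starRingEnd ℂ) (RingHom.id ℂ)
    (fun φ ψ => inner ℂ (toFock d (expAnnihil g φ)) (secondQuantFin ϖ (expAnnihil g ψ)))
    (fun _ _ _ => by rw [map_add, map_add, inner_add_left])
    (fun c φ _ => by
      rw [(expAnnihil g).map_smul c φ, (toFock d).map_smul c]; exact inner_smul_left _ _ _)
    (fun _ _ _ => by rw [map_add, map_add, inner_add_right])
    (fun c _ ψ => by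
      rw [(expAnnihil g).map_smul c ψ, (secondQuantFin ϖ).map_smul c]
      exact inner_smul_right _ _ _)
  symm φ ψ := by
    change (starRingEnd ℂ) (inner ℂ (toFock d (expAnnihil g φ))
      (secondQuantFin ϖ (expAnnihil g ψ))) = inner ℂ (toFock d (expAnnihil g ψ))
      (secondQuantFin ϖ (expAnnihil g φ))
    rw [secondQuantFin_symm]
    exact inner_conj_symm _ _
  nonneg ψ := secondQuantFin_nonneg ϖ (expAnnihil g ψ)

theorem dressedForm_isClosable {d : ℕ} (ϖ : Dispersion d) (g : Distr d) :
    (dressedForm ϖ g).IsClosable :=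
  PosForm.isClosable_of_eq_inner _ (fun ψ => toFock d (expAnnihil g ψ))
    (fun ψ => secondQuantFin ϖ (expAnnihil g ψ)) (fun ψ => (norm_toDressed g ψ).symm)
    (fun _ _ => rfl)

/-- The dressed van Hove–Miyatake Hamiltonian `H_g`: the operator on `ℱ_g` of the closure
of `𝔮_g`. -/
def dressedHamiltonian {d : ℕ} (ϖ : Dispersion d) (g : Distr d) :
    DressedSpace g →ₗ.[ℂ] DressedSpace g :=
  (dressedForm ϖ g).operator (dressedForm_isClosable ϖ g)

theorem dressedHamiltonian_graph {d : ℕ} (ϖ : Dispersion d) (g : Distr d) :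
    (dressedHamiltonian ϖ g).graph
      = (dressedForm ϖ g).operatorGraph (dressedForm_isClosable ϖ g) :=
  PosForm.operator_graph _ _ (denseRange_toDressed g)

/-- The composition `U A U*` of an unbounded operator `A` with a bounded operator `U` and its
adjoint, with its natural domain `{x | U* x ∈ D(A)}`. -/
def sandwich {H K : Type*} [NormedAddCommGroup H] [InnerProductSpace ℂ H] [CompleteSpace H]
    [NormedAddCommGroup K] [InnerProductSpace ℂ K] [CompleteSpace K]
    (U : H →L[ℂ] K) (A : H →ₗ.[ℂ] H) : K →ₗ.[ℂ] K where
  domain := A.domain.comap (ContinuousLinearMap.adjoint U).toLinearMap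
  toFun := U.toLinearMap ∘ₗ A.toFun ∘ₗ
    ((ContinuousLinearMap.adjoint U).toLinearMap.restrict fun _ hx => hx)

end VanHove

end

/-!
The operator `e^{a(g)}` is unipotent with respect to the particle number, so it maps `ℱ_fin(𝒟)` onto
itself (`expAnnihil_surjective`). No regularity of `g` enters: the image of the dressing
transformation is always `ℱ_fin(𝒟)`, and everything reduces to properties of `dΓ(ϖ)` on that space.

The one analytic fact is that `dΓ(ϖ)` is essentially self-adjoint on `ℱ_fin(𝒟)`, in the form of
`mem_secondQuantGraph_of_inner`: if `⟨dΓ(ϖ)ψ, x⟩ = ⟨ψ, z⟩` for all `ψ ∈ ℱ_fin(𝒟)`, then `x` lies in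
the maximal domain and `dΓ(ϖ)x = z`. In the `n`-particle sector the hypothesis says that the symmetric
locally integrable function `(ϖ(k₁) + ⋯ + ϖ(kₙ)) x - z` has vanishing integral against every product
`f₁(k₁)⋯fₙ(kₙ)` of test functions, and such products separate locally integrable functions
(`ae_eq_zero_of_integral_prod_testFn`): they approximate the indicator functions of bounded open
boxes, which form a `π`-system generating the Borel sets.

Two consequences are immediate. Taking `x = 0` shows that `ℱ_fin(𝒟)` is dense in `ℱ`, so the isometry
`ι_g` has dense range and is unitary. Taking `z = -x` shows that `(dΓ(ϖ) + 1)ℱ_fin(𝒟)` is dense, and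
since `dΓ(ϖ) ≥ 0` this makes `ℱ_fin(𝒟)` a core for `dΓ(ϖ)` (`secondQuantGraph_subset_closure`).

Finally `mem_dressedHamiltonian_graph` identifies the graph of `H_g` with the preimage of the graph of
`dΓ(ϖ)` under `ι_g`: graph norm approximation by finite particle vectors gives one inclusion, and
testing the closed form against finite particle vectors gives the other. Self-adjointness, the
core property and the equality `ι_g H_g ι_g* = dΓ(ϖ)` are read off from this description.
-/

namespace VanHove

/-! ### Products of test functions separate locally integrable functions -/

/-- The approximants are `1 - (1 - φ)ᵐ`, where `φ : ℝ^d → [0, 1]` is smooth with support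
exactly `U`. -/
theorem exists_testFn_tendsto_indicator {d : ℕ} {U : Set (Momentum d)} (hU : IsOpen U)
    (hb : Bornology.IsBounded U) :
    ∃ f : ℕ → TestFn d, (∀ m x, ‖f m x‖ ≤ 1) ∧ (∀ m, ∀ x ∉ U, f m x = 0) ∧
      ∀ x ∈ U, Tendsto (fun m => f m x) atTop (𝓝 1) := by
  obtain ⟨φ, hφU, hφ, hr⟩ := hU.exists_contDiff_support_eq (n := ⊤)
  have h0 : ∀ x, 0 ≤ φ x ∧ φ x ≤ 1 := fun x => hr ⟨x, rfl⟩
  have hout : ∀ x ∉ U, φ x = 0 := fun x hx => by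
    rw [← hφU] at hx
    exact Function.notMem_support.1 hx
  let f : ℕ → TestFn d := fun m =>
    { toFun := fun x => ((1 - (1 - φ x) ^ m : ℝ) : ℂ)
      contDiff' := Complex.ofRealCLM.contDiff.comp
        (contDiff_const.sub ((contDiff_const.sub hφ).pow m))
      hasCompactSupport' := HasCompactSupport.intro hb.isCompact_closure fun x hx => by
        simp [hout x fun h => hx (subset_closure h)]
      tsupport_subset' := fun _ _ => trivial }
  have hf : ∀ m x, f m x = ((1 - (1 - φ x) ^ m : ℝ) : ℂ) := fun _ _ => rfl
  refine ⟨f, fun m x => ?_, fun m x hx => ?_, fun x hx => ?_⟩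
  · rw [hf, Complex.norm_real, Real.norm_eq_abs, abs_le]
    have h1 : 0 ≤ (1 - φ x) ^ m := pow_nonneg (by linarith [(h0 x).2]) m
    have h2 : (1 - φ x) ^ m ≤ 1 := pow_le_one₀ (by linarith [(h0 x).2]) (by linarith [(h0 x).1])
    constructor <;> linarith
  · simp [hf, hout x hx]
  · have hx0 : φ x ≠ 0 := by
      rw [← hφU] at hx
      exact hx
    have hpos : 0 < φ x := lt_of_le_of_ne (h0 x).1 hx0.symm
    have h1 : Tendsto (fun m : ℕ => (1 - φ x) ^ m) atTop (𝓝 0) :=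
      tendsto_pow_atTop_nhds_zero_of_lt_one (by linarith [(h0 x).2]) (by linarith)
    have h2 := (Complex.continuous_ofReal.tendsto _).comp (h1.const_sub 1)
    simpa [Function.comp_def, hf] using h2

theorem setIntegral_pi_eq_zero {d n : ℕ} {h : (Fin n → Momentum d) → ℂ}
    (hloc : LocallyIntegrable h)
    (hz : ∀ f : Fin n → TestFn d, ∫ k, (∏ i, f i (k i)) * h k = 0)
    {U : Fin n → Set (Momentum d)} (hU : ∀ i, IsOpen (U i))
    (hb : ∀ i, Bornology.IsBounded (U i)) : ∫ k in Set.univ.pi U, h k = 0 := by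
  choose f hf1 hf0 hfU using fun i => exists_testFn_tendsto_indicator (hU i) (hb i)
  have hmeas : MeasurableSet (Set.univ.pi U) :=
    MeasurableSet.univ_pi fun i => (hU i).measurableSet
  have hint : IntegrableOn h (Set.univ.pi U) :=
    (hloc.integrableOn_isCompact (isCompact_univ_pi fun i => (hb i).isCompact_closure)).mono_set
      (Set.pi_mono fun i _ => subset_closure)
  have hlim : Tendsto (fun m => ∫ k, (∏ i, f i m (k i)) * h k) atTop
      (𝓝 (∫ k, (Set.univ.pi U).indicator h k)) := by
    refine tendsto_integral_of_dominated_convergence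
      (fun k => ‖(Set.univ.pi U).indicator h k‖) (fun m => ?_)
      ((integrable_indicator_iff hmeas).2 hint).norm (fun m => ?_) ?_
    · refine AEStronglyMeasurable.mul ?_ hloc.aestronglyMeasurable
      exact (continuous_finsetProd _ fun i _ =>
        (f i m).continuous.comp (continuous_apply i)).aestronglyMeasurable
    · refine Eventually.of_forall fun k => ?_
      by_cases hk : k ∈ Set.univ.pi U
      · rw [Set.indicator_of_mem hk, norm_mul, norm_prod]
        exact mul_le_of_le_one_left (norm_nonneg _)
          (Finset.prod_le_one (fun i _ => norm_nonneg _) fun i _ => hf1 i m _)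
      · obtain ⟨i, hi⟩ : ∃ i, k i ∉ U i := by simpa [Set.mem_univ_pi] using hk
        rw [Finset.prod_eq_zero (Finset.mem_univ i) (hf0 i m _ hi)]
        simp
    · refine Eventually.of_forall fun k => ?_
      by_cases hk : k ∈ Set.univ.pi U
      · rw [Set.indicator_of_mem hk]
        have h1 := tendsto_finsetProd Finset.univ
          fun i _ => hfU i (k i) (hk i (Set.mem_univ i))
        simpa using h1.mul_const (h k)
      · obtain ⟨i, hi⟩ : ∃ i, k i ∉ U i := by simpa [Set.mem_univ_pi] using hk
        rw [Set.indicator_of_notMem hk]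
        refine tendsto_const_nhds.congr fun m => ?_
        rw [Finset.prod_eq_zero (Finset.mem_univ i) (hf0 i m _ hi), zero_mul]
  rw [integral_indicator hmeas] at hlim
  refine tendsto_nhds_unique hlim ?_
  simp only [hz]
  exact tendsto_const_nhds

/-- Products of test functions separate locally integrable functions: bounded open boxes form a
`π`-system generating the Borel sets, so the integral of `h` over every bounded Borel set vanishes. -/
theorem ae_eq_zero_of_integral_prod_testFn {d n : ℕ} {h : (Fin n → Momentum d) → ℂ}
    (hloc : LocallyIntegrable h)
    (hz : ∀ f : Fin n → TestFn d, ∫ k, (∏ i, f i (k i)) * h k = 0) : ∀ᵐ k, h k = 0 := by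
  have key : ∀ R : ℕ, ∀ᵐ k : Fin n → Momentum d,
      k ∈ (Set.univ.pi fun _ => Metric.ball 0 (R : ℝ)) → h k = 0 := by
    intro R
    set B : Set (Fin n → Momentum d) := Set.univ.pi fun _ => Metric.ball 0 (R : ℝ) with hB
    have hBm : MeasurableSet B := MeasurableSet.univ_pi fun i => measurableSet_ball
    have hint : Integrable h (volume.restrict B) :=
      (hloc.integrableOn_isCompact
        (isCompact_univ_pi fun _ : Fin n => isCompact_closedBall (0 : Momentum d) R)).mono_set
        (Set.pi_mono fun i _ => Metric.ball_subset_closedBall)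
    have htot : ∫ k in B, h k = 0 :=
      setIntegral_pi_eq_zero hloc hz (fun _ => Metric.isOpen_ball) fun _ => Metric.isBounded_ball
    have hgen : (MeasurableSpace.pi : MeasurableSpace (Fin n → Momentum d))
        = MeasurableSpace.generateFrom
          (Set.univ.pi '' Set.univ.pi fun _ => {s : Set (Momentum d) | IsOpen s}) := by
      refine (generateFrom_eq_pi (fun _ => ?_) fun _ => ?_).symm
      · exact (BorelSpace.measurable_eq (α := Momentum d)).symm
      · exact ⟨fun _ => Set.univ, fun _ => Set.mem_ofPred.2 isOpen_univ, Set.iUnion_const _⟩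
    refine (ae_restrict_iff' hBm).1
      (Integrable.ae_eq_zero_of_forall_setIntegral_eq_zero hint fun s hs _ => ?_)
    refine MeasurableSpace.induction_on_inter (C := fun s _ => ∫ k in s, h k ∂volume.restrict B = 0)
      hgen (IsPiSystem.pi fun _ => isPiSystem_isOpen) (by simp) ?_ ?_ ?_ s hs
    · rintro _ ⟨U, hU, rfl⟩
      have hUo : ∀ i, IsOpen (U i) := fun i => hU i (Set.mem_univ i)
      rw [Measure.restrict_restrict (MeasurableSet.univ_pi fun i => (hUo i).measurableSet), hB,
        ← Set.pi_inter_distrib]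
      exact setIntegral_pi_eq_zero hloc hz (fun i => (hUo i).inter Metric.isOpen_ball)
        fun i => Metric.isBounded_ball.subset Set.inter_subset_right
    · intro t ht h0
      rw [setIntegral_compl ht hint, h0, htot, sub_zero]
    · intro t hd ht h0
      rw [integral_iUnion ht hd hint.integrableOn]
      simp [h0]
  filter_upwards [ae_all_iff.2 key] with k hk
  obtain ⟨R, hR⟩ := exists_nat_gt ‖k‖
  refine hk R fun i _ => ?_
  rw [mem_ball_zero_iff]
  exact (norm_le_pi_norm k i).trans_lt hR

theorem integrable_prod_testFn_mul {d n : ℕ} {h : (Fin n → Momentum d) → ℂ}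
    (hloc : LocallyIntegrable h) (f : Fin n → TestFn d) :
    Integrable fun k => (∏ i, f i (k i)) * h k := by
  refine hloc.integrable_smul_left_of_hasCompactSupport
    (continuous_finsetProd _ fun i _ => (f i).continuous.comp (continuous_apply i)) ?_
  refine HasCompactSupport.intro
    (isCompact_univ_pi fun i => (f i).hasCompactSupport) fun k hk => ?_
  by_contra h0
  exact hk fun i _ => subset_tsupport _ (Finset.prod_ne_zero_iff.1 h0 i (Finset.mem_univ i))

/-- Testing a symmetric function against `f₁ ⊗ₛ ⋯ ⊗ₛ fₙ` is the same as testing it against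
`f₁ ⊗ ⋯ ⊗ fₙ`. -/
theorem integral_symProd_mul {d n : ℕ} {h : (Fin n → Momentum d) → ℂ}
    (hloc : LocallyIntegrable h) (hs : ∀ σ : Equiv.Perm (Fin n), ∀ᵐ k, h (k ∘ σ) = h k)
    (f : Fin n → TestFn d) : ∫ k, symProd f k * h k = ∫ k, (∏ i, f i (k i)) * h k := by
  have hσ : ∀ σ : Equiv.Perm (Fin n),
      ∫ k, (∏ i, f (σ i) (k i)) * h k = ∫ k, (∏ i, f i (k i)) * h k := by
    intro σ
    have hmp := volume_preserving_arrowCongr' σ.symm (MeasurableEquiv.refl (Momentum d)) (.id volume)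
    rw [← hmp.integral_comp']
    refine integral_congr_ae ?_
    filter_upwards [hs σ] with k hk
    change (∏ i, f (σ i) (k (σ i))) * h (k ∘ σ) = _
    rw [hk, Equiv.prod_comp σ fun i => f i (k i)]
  have hc : (n.factorial : ℂ) ≠ 0 := by exact_mod_cast n.factorial_ne_zero
  simp only [symProd, mul_assoc, Finset.sum_mul]
  rw [integral_const_mul,
    integral_finsetSum _ fun σ _ => integrable_prod_testFn_mul hloc fun i => f (σ i)]
  simp only [hσ]
  simp [Fintype.card_perm, hc]

/-! ### Essential self-adjointness of `dΓ(ϖ)` on the finite particle vectors -/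

theorem Dispersion.aestronglyMeasurable {d : ℕ} (ϖ : Dispersion d) :
    AEStronglyMeasurable ϖ.toFun volume := by
  rw [← Measure.restrict_univ (μ := volume), ← Metric.iUnion_closedBall_nat (0 : Momentum d)]
  exact AEStronglyMeasurable.iUnion fun m =>
    (ϖ.locallyBounded _ (isCompact_closedBall _ _)).aestronglyMeasurable

theorem Dispersion.ae_norm_sum_le {d : ℕ} (ϖ : Dispersion d) (n : ℕ) {K : Set (Momentum d)}
    (hK : IsCompact K) :
    ∃ C : ℝ, ∀ᵐ k : Fin n → Momentum d, (∀ i, k i ∈ K) → ‖((∑ i, ϖ (k i) : ℝ) : ℂ)‖ ≤ C := by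
  obtain ⟨C, hC⟩ : ∃ C : ℝ, ∀ᵐ x : Momentum d, x ∈ K → ‖ϖ x‖ ≤ C :=
    ⟨_, (ae_restrict_iff' hK.measurableSet).1
      (MeasureTheory.ae_le_lpNorm_exponent_top (ϖ.locallyBounded K hK))⟩
  refine ⟨∑ _i : Fin n, C, ?_⟩
  filter_upwards [ae_all_iff.2 fun i : Fin n =>
    (Measure.quasiMeasurePreserving_eval (fun _ => volume) i).ae hC] with k hk hkK
  rw [Complex.norm_real]
  exact (norm_sum_le _ _).trans (Finset.sum_le_sum fun i _ => hk i (hkK i))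

theorem locallyIntegrable_dispersion_mul {d n : ℕ} (ϖ : Dispersion d)
    (u : Lp ℂ 2 (volume : Measure (Fin n → Momentum d))) :
    LocallyIntegrable fun k => ((∑ i, ϖ (k i) : ℝ) : ℂ) * u k := by
  have hu : LocallyIntegrable (u : (Fin n → Momentum d) → ℂ) :=
    (Lp.memLp u).locallyIntegrable (by norm_num)
  have hm : AEStronglyMeasurable
      (fun k : Fin n → Momentum d => ((∑ i, ϖ (k i) : ℝ) : ℂ)) volume := by
    refine Complex.continuous_ofReal.comp_aestronglyMeasurable ?_
    exact Finset.aestronglyMeasurable_fun_sum _ fun i _ =>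
      ϖ.aestronglyMeasurable.comp_quasiMeasurePreserving
        (Measure.quasiMeasurePreserving_eval (fun _ => volume) i)
  refine locallyIntegrable_iff.2 fun L hL => ?_
  obtain ⟨C, hC⟩ := ϖ.ae_norm_sum_le n
    (isCompact_iUnion fun i : Fin n => hL.image (continuous_apply i))
  refine Integrable.bdd_mul (c := C) (hu.integrableOn_isCompact hL) hm.restrict ?_
  refine (ae_restrict_iff' hL.measurableSet).2 ?_
  filter_upwards [hC] with k hk hkL
  exact hk fun i => Set.mem_iUnion.2 ⟨i, k, hkL, rfl⟩

theorem secondQuantGraph_component {d : ℕ} {ϖ : Momentum d → ℝ} {p : Fock d × Fock d}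
    (hp : p ∈ secondQuantGraph ϖ) {n : ℕ} (h0 : p.1 n = 0) : p.2 n = 0 := by
  apply Subtype.ext
  apply Lp.ext
  filter_upwards [hp n, Lp.coeFn_zero ℂ 2 (volume : Measure (Fin n → Momentum d))] with k h1 h2
  rw [h1, h0, ZeroMemClass.coe_zero, h2, Pi.zero_apply, mul_zero]

theorem toFock_of_apply_ne {d n m : ℕ} (h : m ≠ n) (Ψ : FinSector d n) :
    toFock d (FinParticle.of d n Ψ) m = 0 := by
  rw [toFock_apply, FinParticle.component_of_ne h, map_zero]

theorem inner_eq_component {d : ℕ} {u v : Fock d} {n : ℕ} (h : ∀ m ≠ n, u m = 0) :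
    inner ℂ u v = inner ℂ (u n) (v n) := by
  change ∑' m, inner ℂ (u m) (v m) = _
  exact tsum_eq_single n fun m hm => by rw [h m hm, inner_zero_left]

theorem conj_symProd_conj {d n : ℕ} (f : Fin n → TestFn d) (k : Fin n → Momentum d) :
    (starRingEnd ℂ) (symProd (fun i => (f i).conj) k) = symProd f k := by
  have h : ∀ (i : Fin n) (x : Momentum d), (starRingEnd ℂ) ((f i).conj x) = f i x :=
    fun i x => Complex.conj_conj _
  simp only [symProd, map_mul, map_inv₀, map_natCast, map_sum, map_prod, h]

/-- Essential self-adjointness of `dΓ(ϖ)` on `ℱ_fin(𝒟)`: a vector on which the adjoint of the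
restriction acts as `z` lies in the maximal domain. In each sector the hypothesis says that
`(ϖ(k₁) + ⋯ + ϖ(kₙ)) x⁽ⁿ⁾ - z⁽ⁿ⁾`, a symmetric locally integrable function, vanishes against all
products of test functions. -/
theorem mem_secondQuantGraph_of_inner {d : ℕ} (ϖ : Dispersion d) {x z : Fock d}
    (hxz : ∀ ψ : FinParticle d, inner ℂ (secondQuantFin ϖ ψ) x = inner ℂ (toFock d ψ) z) :
    (x, z) ∈ secondQuantGraph ϖ := by
  intro n
  set u : Lp ℂ 2 (volume : Measure (Fin n → Momentum d)) := (x n).1 with hu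
  set v : Lp ℂ 2 (volume : Measure (Fin n → Momentum d)) := (z n).1 with hv
  let h : (Fin n → Momentum d) → ℂ := fun k => ((∑ i, ϖ (k i) : ℝ) : ℂ) * u k - v k
  have hloc : LocallyIntegrable h :=
    (locallyIntegrable_dispersion_mul ϖ u).sub ((Lp.memLp v).locallyIntegrable (by norm_num))
  have hsym : ∀ σ : Equiv.Perm (Fin n), ∀ᵐ k, h (k ∘ σ) = h k := fun σ => by
    filter_upwards [mem_symL2.1 (x n).2 σ, mem_symL2.1 (z n).2 σ] with k h1 h2
    have h3 : ∑ i, ϖ ((k ∘ σ) i) = ∑ i, ϖ (k i) := Equiv.sum_comp σ fun i => ϖ (k i)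
    simp only [h, h3]
    rw [hu, hv, h1, h2]
  suffices hz : ∀ᵐ k, h k = 0 by
    filter_upwards [hz] with k hk
    exact (sub_eq_zero.1 hk).symm
  refine ae_eq_zero_of_integral_prod_testFn hloc fun f => ?_
  rw [← integral_symProd_mul hloc hsym]
  let Ψ : FinSector d n := symTensor fun i => (f i).conj
  set ψ := FinParticle.of d n Ψ with hψ
  set a : Lp ℂ 2 (volume : Measure (Fin n → Momentum d)) := (toFock d ψ n).1 with ha
  set b : Lp ℂ 2 (volume : Measure (Fin n → Momentum d)) := (secondQuantFin ϖ ψ n).1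
    with hb
  have hgraph := secondQuantFin_graph ϖ ψ
  have e : inner ℂ b u = inner ℂ a v := by
    have h1 := hxz ψ
    rw [inner_eq_component fun m hm => toFock_of_apply_ne hm Ψ,
      inner_eq_component (n := n) fun m hm =>
        secondQuantGraph_component hgraph (toFock_of_apply_ne hm Ψ)] at h1
    exact h1
  have ha' : ∀ᵐ k, a k = symProd (fun i => (f i).conj) k := by
    have h1 : a = (FinSector.memLp Ψ).toLp _ := by
      rw [ha, hψ, toFock_apply, FinParticle.component_of_self]; rfl
    rw [h1]
    exact (FinSector.memLp Ψ).coeFn_toLp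
  have e2 : ∫ k, symProd f k * h k = inner ℂ b u - inner ℂ a v := by
    rw [L2.inner_def, L2.inner_def,
      ← integral_sub (L2.integrable_inner b u) (L2.integrable_inner a v)]
    refine integral_congr_ae ?_
    filter_upwards [ha', hgraph n] with k h1 h2
    rw [RCLike.inner_apply, RCLike.inner_apply]
    have h3 : b k = ((∑ i, ϖ (k i) : ℝ) : ℂ) * a k := h2
    rw [h3, h1, map_mul, Complex.conj_ofReal, conj_symProd_conj]
    simp only [h]
    ring
  rw [e2, e, sub_self]

/-- The finite particle vectors over `𝒟` are dense in Fock space: for any `ϖ`, a vector `v`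
orthogonal to all of them gives an element `(0, v)` of the graph of `dΓ(ϖ)`. -/
theorem denseRange_toFock (d : ℕ) : DenseRange (toFock d) := by
  let ϖ : Dispersion d :=
    { toFun := fun _ => 1
      locallyBounded := fun _ _ => memLp_top_const 1
      exists_mass := ⟨1, one_pos, Eventually.of_forall fun _ => le_rfl⟩ }
  refine (Submodule.dense_iff_topologicalClosure_eq_top (s := LinearMap.range (toFock d))).2 ?_
  rw [Submodule.topologicalClosure_eq_top_iff, Submodule.eq_bot_iff]
  intro v hv
  refine secondQuantGraph_single ϖ (0, v) (mem_secondQuantGraph_of_inner ϖ fun ψ => ?_) rfl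
  rw [inner_zero_right, (Submodule.mem_orthogonal _ v).1 hv _ ⟨ψ, rfl⟩]

/-- The range of `dΓ(ϖ) + 1` on the finite particle vectors is dense: a vector orthogonal to it
would be an eigenvector of the nonnegative operator `dΓ(ϖ)` with eigenvalue `-1`. -/
theorem denseRange_toFock_add_secondQuantFin {d : ℕ} (ϖ : Dispersion d) :
    DenseRange (toFock d + secondQuantFin ϖ) := by
  refine (Submodule.dense_iff_topologicalClosure_eq_top
    (s := LinearMap.range (toFock d + secondQuantFin ϖ))).2 ?_
  rw [Submodule.topologicalClosure_eq_top_iff, Submodule.eq_bot_iff]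
  intro v hv
  have h : (v, -v) ∈ secondQuantGraph ϖ := mem_secondQuantGraph_of_inner ϖ fun ψ => by
    have h1 := (Submodule.mem_orthogonal _ v).1 hv _ ⟨ψ, rfl⟩
    rw [LinearMap.add_apply, inner_add_left] at h1
    rw [inner_neg_right]
    exact eq_neg_of_add_eq_zero_right h1
  have h2 := re_inner_secondQuantGraph ϖ h
  simp only [inner_neg_right, Complex.neg_re, Left.nonneg_neg_iff] at h2
  exact (re_inner_self_nonpos (𝕜 := ℂ)).1 h2

theorem norm_le_norm_add_of_re_inner_nonneg {E : Type*} [NormedAddCommGroup E]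
    [InnerProductSpace ℂ E] {x y : E} (h : 0 ≤ (inner ℂ x y).re) : ‖x‖ ≤ ‖x + y‖ := by
  refine le_of_sq_le_sq ?_ (norm_nonneg _)
  rw [@norm_add_sq ℂ]
  have : 0 ≤ RCLike.re (inner ℂ x y) := h
  nlinarith [sq_nonneg ‖y‖]

/-- `ℱ_fin(𝒟)` is a core for `dΓ(ϖ)`. Since `dΓ(ϖ)` is nonnegative, the graph norm is controlled
by the norm of `(dΓ(ϖ) + 1)ψ`. -/
theorem secondQuantGraph_subset_closure {d : ℕ} (ϖ : Dispersion d) {p : Fock d × Fock d}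
    (hp : p ∈ secondQuantGraph ϖ) :
    p ∈ closure (Set.range fun ψ => (toFock d ψ, secondQuantFin ϖ ψ)) := by
  refine Metric.mem_closure_range_iff.2 fun ε hε => ?_
  obtain ⟨ψ, hψ⟩ :=
    Metric.denseRange_iff.1 (denseRange_toFock_add_secondQuantFin ϖ) (p.1 + p.2) ε hε
  refine ⟨ψ, ?_⟩
  have hq : p - (toFock d ψ, secondQuantFin ϖ ψ) ∈ secondQuantGraph ϖ :=
    sub_mem hp (secondQuantFin_graph ϖ ψ)
  set q := p - (toFock d ψ, secondQuantFin ϖ ψ) with hqdef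
  have hre := re_inner_secondQuantGraph ϖ hq
  have e : p.1 + p.2 - (toFock d + secondQuantFin ϖ) ψ = q.1 + q.2 := by
    rw [hqdef, LinearMap.add_apply, Prod.fst_sub, Prod.snd_sub]
    abel
  rw [dist_eq_norm, e] at hψ
  rw [dist_eq_norm, ← hqdef, Prod.norm_def]
  refine max_lt ((norm_le_norm_add_of_re_inner_nonneg hre).trans_lt hψ) ?_
  rw [add_comm] at hψ
  refine (norm_le_norm_add_of_re_inner_nonneg ?_).trans_lt hψ
  rw [← inner_conj_symm, Complex.conj_re]
  exact hre

/-! ### Unitarity of the dressing transformation -/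

theorem annihil_of_succ {d : ℕ} (g : Distr d) (n : ℕ) (Ψ : FinSector d (n + 1)) :
    ∃ Φ : FinSector d n, annihil g (FinParticle.of d (n + 1) Ψ) = FinParticle.of d n Φ :=
  ⟨_, FinParticle.lift_of _ _ _⟩

theorem annihil_pow_succ_of_mem {d : ℕ} (g : Distr d) {R : Submodule ℂ (FinParticle d)} (n : ℕ)
    (hR : ∀ m < n, ∀ Φ, FinParticle.of d m Φ ∈ R) (Ψ : FinSector d n) (k : ℕ) :
    (annihil g ^ (k + 1)) (FinParticle.of d n Ψ) ∈ R := by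
  induction n generalizing k with
  | zero =>
    rw [pow_succ, Module.End.mul_apply, annihil_of_zero, map_zero]
    exact zero_mem R
  | succ n ih =>
    obtain ⟨Φ, hΦ⟩ := annihil_of_succ g n Ψ
    rw [pow_succ, Module.End.mul_apply, hΦ]
    cases k with
    | zero => exact hR n n.lt_succ_self Φ
    | succ k => exact ih (fun m hm => hR m (hm.trans n.lt_succ_self)) Φ k

/-- `e^{a(g)}` is the identity up to terms of lower particle number, hence onto. -/
theorem expAnnihil_surjective {d : ℕ} (g : Distr d) : Function.Surjective (expAnnihil g) := by
  have hof : ∀ n (Ψ : FinSector d n),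
      FinParticle.of d n Ψ ∈ LinearMap.range (expAnnihil g) := by
    intro n
    induction n using Nat.strong_induction_on with
    | _ n ih =>
      intro Ψ
      have h : expAnnihil g (FinParticle.of d n Ψ) = ∑ k ∈ Finset.range n,
          (((k + 1).factorial : ℂ)⁻¹ • (annihil g ^ (k + 1)) (FinParticle.of d n Ψ))
            + FinParticle.of d n Ψ := by
        rw [expAnnihil, FinParticle.lift_of, LinearMap.sum_apply, Finset.sum_range_succ']
        simp
      rw [eq_sub_of_add_eq' h.symm]
      exact sub_mem ⟨_, rfl⟩ (sum_mem fun k _ =>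
        Submodule.smul_mem _ _ (annihil_pow_succ_of_mem g n ih Ψ k))
  intro ψ
  induction ψ using FinParticle.induction with
  | h0 => exact ⟨0, map_zero _⟩
  | hof n Ψ => exact hof n Ψ
  | hadd x y hx hy => exact (LinearMap.range (expAnnihil g)).add_mem hx hy

theorem norm_iota {d : ℕ} (g : Distr d) (x : DressedSpace g) : ‖iota g x‖ = ‖x‖ := by
  refine (denseRange_toDressed g).induction_on x
    (isClosed_eq (iota g).continuous.norm continuous_norm) fun ψ => ?_
  rw [iota_toDressed, norm_toDressed]

theorem iota_surjective {d : ℕ} (g : Distr d) : Function.Surjective (iota g) := by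
  have hiso : Isometry (iota g) := AddMonoidHomClass.isometry_of_norm _ (norm_iota g)
  have hd : DenseRange (iota g) := (denseRange_toFock d).mono <| by
    rintro _ ⟨ψ, rfl⟩
    obtain ⟨φ, rfl⟩ := expAnnihil_surjective g ψ
    exact ⟨toDressed g φ, iota_toDressed g φ⟩
  rw [← Set.range_eq_univ, ← hiso.isClosedEmbedding.isClosed_range.closure_eq]
  exact hd.closure_eq

/-- The dressing transformation `ι_g` as a unitary operator from `ℱ_g` onto `ℱ`. -/
noncomputable def iotaEquiv {d : ℕ} (g : Distr d) : DressedSpace g ≃ₗᵢ[ℂ] Fock d :=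
  LinearIsometryEquiv.ofSurjective
    { toLinearMap := (iota g).toLinearMap, norm_map' := norm_iota g } (iota_surjective g)

theorem iotaEquiv_apply {d : ℕ} (g : Distr d) (x : DressedSpace g) :
    iotaEquiv g x = iota g x := rfl

theorem iotaEquiv_toDressed {d : ℕ} (g : Distr d) (ψ : FinParticle d) :
    iotaEquiv g (toDressed g ψ) = toFock d (expAnnihil g ψ) := iota_toDressed g ψ

theorem adjoint_iota_apply {d : ℕ} (g : Distr d) (y : Fock d) :
    ContinuousLinearMap.adjoint (iota g) y = (iotaEquiv g).symm y := by
  refine ext_inner_left ℂ fun x => ?_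
  rw [ContinuousLinearMap.adjoint_inner_right, ← iotaEquiv_apply,
    ← (iotaEquiv g).inner_map_map x, LinearIsometryEquiv.apply_symm_apply]

/-! ### The dressed Hamiltonian as the pull-back of `dΓ(ϖ)` -/

theorem dressedForm_apply {d : ℕ} (ϖ : Dispersion d) (g : Distr d) (φ ψ : FinParticle d) :
    (dressedForm ϖ g).form φ ψ
      = inner ℂ (toFock d (expAnnihil g φ)) (secondQuantFin ϖ (expAnnihil g ψ)) := rfl

/-- Each element of the graph of `dΓ(ϖ)` is approximated, in graph norm, by dressed finite particle
vectors. -/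
theorem exists_seq_tendsto_of_mem_secondQuantGraph {d : ℕ} (ϖ : Dispersion d) (g : Distr d)
    {p : Fock d × Fock d} (hp : p ∈ secondQuantGraph ϖ) :
    ∃ ψ : ℕ → FinParticle d,
      Tendsto (fun n => toFock d (expAnnihil g (ψ n))) atTop (𝓝 p.1) ∧
        Tendsto (fun n => secondQuantFin ϖ (expAnnihil g (ψ n))) atTop (𝓝 p.2) := by
  obtain ⟨u, hu, hlim⟩ := mem_closure_iff_seq_limit.1 (secondQuantGraph_subset_closure ϖ hp)
  choose φ hφ using hu
  choose ψ hψ using fun n => expAnnihil_surjective g (φ n)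
  refine ⟨ψ, ?_, ?_⟩
  · refine ((continuous_fst.tendsto p).comp hlim).congr fun n => ?_
    rw [hψ, Function.comp_apply, ← hφ]
  · refine ((continuous_snd.tendsto p).comp hlim).congr fun n => ?_
    rw [hψ, Function.comp_apply, ← hφ]

/-- A vector `x` with `ι_g x` in the domain of `dΓ(ϖ)` is tested against the closed form through
sequences that converge in graph norm; conversely, testing against `ℱ_fin(𝒟)` alone suffices since
`dΓ(ϖ)` is essentially self-adjoint there. -/
theorem mem_dressedHamiltonian_graph {d : ℕ} (ϖ : Dispersion d) (g : Distr d)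
    {p : DressedSpace g × DressedSpace g} :
    p ∈ (dressedHamiltonian ϖ g).graph
      ↔ (iotaEquiv g p.1, iotaEquiv g p.2) ∈ secondQuantGraph ϖ := by
  rw [dressedHamiltonian_graph]
  have hT : ∀ {ψ : ℕ → FinParticle d} {x : DressedSpace g},
      Tendsto (fun n => toDressed g (ψ n)) atTop (𝓝 x) ↔
        Tendsto (fun n => toFock d (expAnnihil g (ψ n))) atTop (𝓝 (iotaEquiv g x)) := by
    intro ψ x
    simp only [← iotaEquiv_toDressed]
    exact (iotaEquiv g).toHomeomorph.isInducing.tendsto_nhds_iff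
  constructor
  · rintro ⟨hx, h⟩
    refine mem_secondQuantGraph_of_inner ϖ fun ψ => ?_
    obtain ⟨φ, rfl⟩ := expAnnihil_surjective g ψ
    obtain ⟨χ, hχ⟩ := id hx
    have h1 := PosForm.tendsto_closureForm (dressedForm_isClosable ϖ g)
      (y := ⟨_, (dressedForm ϖ g).emb_mem_closureDomain φ⟩) (x := ⟨p.1, hx⟩)
      (PosForm.FormTendsto.const _ φ) hχ
    rw [h] at h1
    simp only [dressedForm_apply, secondQuantFin_symm] at h1
    have h2 := Filter.Tendsto.inner (𝕜 := ℂ)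
      (tendsto_const_nhds (x := secondQuantFin ϖ (expAnnihil g φ))) (hT.1 hχ.1)
    refine (tendsto_nhds_unique h2 h1).trans ?_
    change inner ℂ (toDressed g φ) p.2 = _
    rw [← (iotaEquiv g).inner_map_map, iotaEquiv_toDressed]
  · intro hp
    obtain ⟨ψ, h1, h2⟩ := exists_seq_tendsto_of_mem_secondQuantGraph ϖ g hp
    have hψ : (dressedForm ϖ g).FormTendsto ψ p.1 := by
      refine ⟨hT.2 h1, ?_⟩
      have hcauchy : ∀ {u : ℕ → Fock d} {a : Fock d}, Tendsto u atTop (𝓝 a) →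
          Tendsto (fun q : ℕ × ℕ => u q.1 - u q.2) atTop (𝓝 0) := by
        intro u a hu
        rw [← prod_atTop_atTop_eq, ← sub_self a]
        exact (hu.comp tendsto_fst).sub (hu.comp tendsto_snd)
      have h3 := Filter.Tendsto.inner (𝕜 := ℂ) (hcauchy h1) (hcauchy h2)
      rw [inner_zero_left] at h3
      refine h3.congr fun q => ?_
      rw [dressedForm_apply]
      simp only [map_sub]
    refine ⟨⟨ψ, hψ⟩, fun y => ?_⟩
    obtain ⟨φ, hφ⟩ := y.2
    have h3 := PosForm.tendsto_closureForm (dressedForm_isClosable ϖ g)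
      (x := ⟨p.1, ⟨ψ, hψ⟩⟩) hφ hψ
    simp only [dressedForm_apply] at h3
    refine (tendsto_nhds_unique h3 (Filter.Tendsto.inner (𝕜 := ℂ) (hT.1 hφ.1) h2)).trans ?_
    exact (iotaEquiv g).inner_map_map _ _

theorem toDressed_mem_dressedHamiltonian_graph {d : ℕ} (ϖ : Dispersion d) (g : Distr d)
    (ψ : FinParticle d) :
    (toDressed g ψ, (iotaEquiv g).symm (secondQuantFin ϖ (expAnnihil g ψ)))
      ∈ (dressedHamiltonian ϖ g).graph := by
  rw [mem_dressedHamiltonian_graph, LinearIsometryEquiv.apply_symm_apply, iotaEquiv_toDressed]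
  exact secondQuantFin_graph ϖ _

theorem range_toDressed_le_domain {d : ℕ} (ϖ : Dispersion d) (g : Distr d) :
    LinearMap.range (toDressed g) ≤ (dressedHamiltonian ϖ g).domain := by
  rintro _ ⟨ψ, rfl⟩
  exact LinearPMap.mem_domain_of_mem_graph (toDressed_mem_dressedHamiltonian_graph ϖ g ψ)

theorem dressedHamiltonian_isSelfAdjoint {d : ℕ} (ϖ : Dispersion d) (g : Distr d) :
    IsSelfAdjoint (dressedHamiltonian ϖ g) := by
  have hdense : Dense ((dressedHamiltonian ϖ g).domain : Set (DressedSpace g)) :=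
    (denseRange_toDressed g).mono (range_toDressed_le_domain ϖ g)
  rw [LinearPMap.isSelfAdjoint_def]
  refine LinearPMap.eq_of_eq_graph ?_
  rw [LinearPMap.adjoint_graph_eq_graph_adjoint hdense]
  ext ⟨x, z⟩
  rw [Submodule.mem_adjoint_iff]
  constructor
  · intro h
    refine (mem_dressedHamiltonian_graph ϖ g).2 (mem_secondQuantGraph_of_inner ϖ fun ψ => ?_)
    obtain ⟨φ, rfl⟩ := expAnnihil_surjective g ψ
    have h1 := sub_eq_zero.1 (h _ _ (toDressed_mem_dressedHamiltonian_graph ϖ g φ))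
    rwa [← (iotaEquiv g).inner_map_map, ← (iotaEquiv g).inner_map_map (toDressed g φ),
      LinearIsometryEquiv.apply_symm_apply, iotaEquiv_toDressed] at h1
  · intro h a b hab
    have h1 := inner_secondQuantGraph ϖ ((mem_dressedHamiltonian_graph ϖ g).1 hab)
      ((mem_dressedHamiltonian_graph ϖ g).1 h)
    simp only [LinearIsometryEquiv.inner_map_map] at h1
    rw [h1, sub_self]

theorem dressedHamiltonian_hasCore {d : ℕ} (ϖ : Dispersion d) (g : Distr d) :
    (dressedHamiltonian ϖ g).HasCore (LinearMap.range (toDressed g)) := by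
  have hclosed := (dressedHamiltonian_isSelfAdjoint ϖ g).isClosed
  have hle : (dressedHamiltonian ϖ g).domRestrict (LinearMap.range (toDressed g))
      ≤ dressedHamiltonian ϖ g := LinearPMap.domRestrict_le
  refine ⟨range_toDressed_le_domain ϖ g, LinearPMap.eq_of_eq_graph ?_⟩
  rw [← (hclosed.isClosable.leIsClosable hle).graph_closure_eq_closure_graph]
  refine le_antisymm (Submodule.topologicalClosure_minimal _ (LinearPMap.le_graph_of_le hle)
    hclosed) fun p hp => ?_
  obtain ⟨ψ, h1, h2⟩ := exists_seq_tendsto_of_mem_secondQuantGraph ϖ g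
    ((mem_dressedHamiltonian_graph ϖ g).1 hp)
  have h3 := ((iotaEquiv g).symm.continuous.tendsto _).comp h1
  have h4 := ((iotaEquiv g).symm.continuous.tendsto _).comp h2
  simp only [LinearIsometryEquiv.symm_apply_apply] at h3 h4
  refine mem_closure_of_tendsto (h3.prodMk_nhds h4) (Eventually.of_forall fun n => ?_)
  have h5 := toDressed_mem_dressedHamiltonian_graph ϖ g (ψ n)
  obtain ⟨y, hy1, hy2⟩ := (LinearPMap.mem_graph_iff _).1 h5
  refine (LinearPMap.mem_graph_iff _).2
    ⟨⟨y, ⟨ψ n, hy1.symm⟩, y.2⟩, ?_, (LinearPMap.domRestrict_apply rfl).trans hy2⟩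
  rw [Function.comp_apply, ← iotaEquiv_toDressed, LinearIsometryEquiv.symm_apply_apply]
  exact hy1

theorem sandwich_dressedHamiltonian {d : ℕ} (ϖ : Dispersion d) (g : Distr d) :
    sandwich (iota g) (dressedHamiltonian ϖ g) = secondQuant ϖ := by
  refine LinearPMap.eq_of_eq_graph ?_
  rw [secondQuant_graph]
  ext ⟨x, z⟩
  have h : (x, z) ∈ secondQuantGraph ϖ ↔
      ((iotaEquiv g).symm x, (iotaEquiv g).symm z) ∈ (dressedHamiltonian ϖ g).graph := by
    rw [mem_dressedHamiltonian_graph, LinearIsometryEquiv.apply_symm_apply,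
      LinearIsometryEquiv.apply_symm_apply]
  rw [h, LinearPMap.mem_graph_iff, LinearPMap.mem_graph_iff]
  constructor
  · rintro ⟨y, rfl, hy⟩
    refine ⟨⟨_, y.2⟩, adjoint_iota_apply g y, ?_⟩
    rw [LinearIsometryEquiv.eq_symm_apply]
    exact hy
  · rintro ⟨y, hy1, hy2⟩
    have hx : ContinuousLinearMap.adjoint (iota g) x = y := (adjoint_iota_apply g x).trans hy1.symm
    have hx' : ContinuousLinearMap.adjoint (iota g) x ∈ (dressedHamiltonian ϖ g).domain :=
      hx ▸ y.2
    refine ⟨⟨x, hx'⟩, rfl, ?_⟩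
    have e : (⟨_, hx'⟩ : (dressedHamiltonian ϖ g).domain) = y := Subtype.ext hx
    change iotaEquiv g (dressedHamiltonian ϖ g ⟨_, hx'⟩) = z
    rw [e, hy2, LinearIsometryEquiv.apply_symm_apply]

end VanHove

theorem mainTheorem1 {d : ℕ} (ϖ : VanHove.Dispersion d) (g : VanHove.Distr d) :
    (ContinuousLinearMap.adjoint (VanHove.iota g) ∘L VanHove.iota g
          = ContinuousLinearMap.id ℂ (VanHove.DressedSpace g) ∧
        VanHove.iota g ∘L ContinuousLinearMap.adjoint (VanHove.iota g)
          = ContinuousLinearMap.id ℂ (VanHove.Fock d)) ∧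
      IsSelfAdjoint (VanHove.dressedHamiltonian ϖ g) ∧
      (VanHove.dressedHamiltonian ϖ g).HasCore (LinearMap.range (VanHove.toDressed g)) ∧
      VanHove.sandwich (VanHove.iota g) (VanHove.dressedHamiltonian ϖ g)
        = VanHove.secondQuant ϖ := by
  refine ⟨⟨?_, ?_⟩, VanHove.dressedHamiltonian_isSelfAdjoint ϖ g,
    VanHove.dressedHamiltonian_hasCore ϖ g, VanHove.sandwich_dressedHamiltonian ϖ g⟩
  · ext1 x
    exact (VanHove.adjoint_iota_apply g _).trans ((VanHove.iotaEquiv g).symm_apply_apply x)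
  · ext1 y
    change VanHove.iota g (ContinuousLinearMap.adjoint (VanHove.iota g) y) = y
    rw [VanHove.adjoint_iota_apply]
    exact (VanHove.iotaEquiv g).apply_symm_apply y
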